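/- Let $m,d\ge 0$ be integers. For each agent $i\in\{1,\dots,m\}$ let $\Pi_i=\begin{bmatrix}\Pi_{i+}\\ \Pi_{i-}\end{bmatrix}\in\mathbb R^{d\times d}$ be a permutation matrix with $\Pi_{i+}\in\mathbb R^{d_i\times d}$ (the features seen by agent $i$) and $\Pi_{i-}\in\mathbb R^{(d-d_i)\times d}$ (the unseen ones), and suppose that every one of the $d$ features is seen by at least one agent. Write $v_{i\pm}=\Pi_{i\pm}v$ for $v\in\mathbb R^d$, and $A_{i+}=\Pi_{i+}A\Pi_{i+}^\top$, $A_{i\pm}=\Pi_{i+}A\Pi_{i-}^\top$, $A_{i\mp}=\Pi_{i-}A\Pi_{i+}^\top$ for $A\in\mathbb R^{d\times d}$. Let $P$ be a probability distribution on $\mathbb R^d$ with finite second moments, mean zero and covariance matrix $\Sigma\succ 0$; let $\theta\in\mathbb R^d$ and $\sigma>0$. For $x\sim P$ put $z_{i+}=x_{i-}-\Sigma_{i\mp}\Sigma_{i+}^{-1}x_{i+}$, and assume that for every $i$ the random vector $x_{i+}\,\theta_{i-}^\top z_{i+}$ is square integrable. Let $T_i=\begin{bmatrix} I_{d_i} &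 \Sigma_{i+}^{-1}\Sigma_{i\pm}\end{bmatrix}\Pi_i\in\mathbb R^{d_i\times d}$. Each agent $i$ has feature vectors $x_i^1,x_i^2,\dots\sim P$ and noise variables $\xi_i^1,\xi_i^2,\dots\sim\mathsf N(0,\sigma^2)$, all of these (over all agents and samples) mutually independent. For $n\ge 0$ let $X_i\in\mathbb R^{n\times d}$ be the matrix with rows $x_i^1,\dots,x_i^n$, let $X_{i+}=X_i\Pi_{i+}^\top$ and $y_i=X_i\theta+(\xi_i^1,\dots,\xi_i^n)^\top$, and let $\hat\theta_i=X_{i+}^\dagger y_i$ be the local least squares estimate, where $\dagger$ is the Moore–Penrose inverse. For positive definite matrices $W_i\in\mathbb R^{d_i\times d_i}$ $(i=1,\dots,m)$ let $$\hat\theta=\hat\theta(W_1,\dots,W_m)=\operatorname*{arg\,min}_{t\in\mathbb R^d}\ \sum_{i=1}^m v_i(t)^\top W_i\,v_i(t),\qquad v_i(t)=t_{i+}+\Sigma_{i+}^{-1}\Sigma_{i\pm}t_{i-}-\hat\theta_i .$$ Then this minimizer exists and is unique (for all data and every $n$), and there is a function $C$ that assigns to $(W_1,\dots,W_m)$ a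 matrix in $\mathbb R^{d\times d}$ such that the following hold. 1. For all positive definite $W_1,\dots,W_m$, the matrix $C(W_1,\dots,W_m)$ is positive semidefinite and $$\sqrt n\,(\hat\theta(W_1,\dots,W_m)-\theta)\ \xrightarrow{\ d\ }\ \mathsf N\bigl(0,C(W_1,\dots,W_m)\bigr)\qquad(n\to\infty).$$ 2. The matrices $$W_i^\star=\Sigma_{i+}\bigl(\mathbb E[x_{i+}\theta_{i-}^\top z_{i+}z_{i+}^\top\theta_{i-}x_{i+}^\top]+\sigma^2\Sigma_{i+}\bigr)^{-1}\Sigma_{i+}$$ are positive definite, and they are an optimal choice of weights: for all positive definite $W_1,\dots,W_m$, in the positive semidefinite order, $$C(W_1,\dots,W_m)\ \succeq\ C(W_1^\star,\dots,W_m^\star)=\Bigl(\sum_{i=1}^m T_i^\top W_i^\star T_i\Bigr)^{-1}.$$ -/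

import Mathlib

open MeasureTheory ProbabilityTheory Filter Matrix
open scoped NNReal

noncomputable section

namespace Collab

/-! ### The Moore–Penrose inverse -/

/-- `B` is a Moore–Penrose inverse of the real matrix `A` (the four Penrose equations). -/
structure IsMoorePenrose {n p : ℕ} (A : Matrix (Fin n) (Fin p) ℝ)
    (B : Matrix (Fin p) (Fin n) ℝ) : Prop where
  mul_mul_left : A * B * A = A
  mul_mul_right : B * A * B = B
  symm_left : (A * B)ᵀ = A * B
  symm_right : (B * A)ᵀ = B * A

theorem exists_isMoorePenrose {n p : ℕ} (A : Matrix (Fin n) (Fin p) ℝ) :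
    ∃ B, IsMoorePenrose A B := by
  have hH : (Aᵀ * A).IsHermitian := by
    simpa [conjTranspose_eq_transpose_of_trivial] using isHermitian_conjTranspose_mul_self A
  obtain ⟨G, hGT, h1, h2, h3⟩ : ∃ G : Matrix (Fin p) (Fin p) ℝ, Gᵀ = G ∧
      (Aᵀ * A) * G * (Aᵀ * A) = Aᵀ * A ∧ G * (Aᵀ * A) * G = G ∧
      (Aᵀ * A) * G = G * (Aᵀ * A) := by
    set U : Matrix (Fin p) (Fin p) ℝ := (hH.eigenvectorUnitary : Matrix (Fin p) (Fin p) ℝ)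
    set D : Matrix (Fin p) (Fin p) ℝ := diagonal hH.eigenvalues
    set E : Matrix (Fin p) (Fin p) ℝ := diagonal (fun k => (hH.eigenvalues k)⁻¹)
    have hU : Uᵀ * U = 1 := by
      have := Unitary.coe_star_mul_self hH.eigenvectorUnitary
      simpa [star_eq_conjTranspose, conjTranspose_eq_transpose_of_trivial] using this
    have hS : Aᵀ * A = U * D * Uᵀ := by
      have := hH.spectral_theorem
      simpa [Unitary.conjStarAlgAut_apply, star_eq_conjTranspose,
        conjTranspose_eq_transpose_of_trivial] using this
    have hc : ∀ X Y : Matrix (Fin p) (Fin p) ℝ,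
        (U * X * Uᵀ) * (U * Y * Uᵀ) = U * (X * Y) * Uᵀ := by
      intro X Y
      calc (U * X * Uᵀ) * (U * Y * Uᵀ) = U * X * (Uᵀ * U) * Y * Uᵀ := by
            simp only [Matrix.mul_assoc]
        _ = U * (X * Y) * Uᵀ := by rw [hU]; simp only [Matrix.mul_assoc, Matrix.one_mul]
    refine ⟨U * E * Uᵀ, ?_, ?_, ?_, ?_⟩
    · simp [E, transpose_mul, Matrix.mul_assoc]
    · rw [hS, hc, hc]
      simp [D, E, diagonal_mul_diagonal]
    · rw [hS, hc, hc]
      have : (fun k => (hH.eigenvalues k)⁻¹ * hH.eigenvalues k * (hH.eigenvalues k)⁻¹) =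
          fun k => (hH.eigenvalues k)⁻¹ := by
        funext k
        by_cases h : hH.eigenvalues k = 0 <;> simp [h]
      simp only [D, E, diagonal_mul_diagonal, this]
    · rw [hS, hc, hc]
      simp [D, E, diagonal_mul_diagonal, mul_comm]
  refine ⟨G * Aᵀ, ?_, ?_, ?_, ?_⟩
  · have h : (A * (G * Aᵀ) * A - A)ᵀ * (A * (G * Aᵀ) * A - A) = 0 := by
      have e1 : A * (G * Aᵀ) * A - A = A * (G * (Aᵀ * A) - 1) := by
        simp only [Matrix.mul_sub, Matrix.mul_assoc, Matrix.mul_one]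
      rw [e1, transpose_mul]
      have e2 : Aᵀ * (A * (G * (Aᵀ * A) - 1)) = 0 := by
        have : Aᵀ * (A * (G * (Aᵀ * A) - 1)) = (Aᵀ * A) * G * (Aᵀ * A) - Aᵀ * A := by
          simp only [Matrix.mul_sub, Matrix.mul_assoc, Matrix.mul_one]
        rw [this, h1, sub_self]
      rw [Matrix.mul_assoc, e2, Matrix.mul_zero]
    have := conjTranspose_mul_self_eq_zero.1
      (by simpa [conjTranspose_eq_transpose_of_trivial] using h :
        (A * (G * Aᵀ) * A - A)ᴴ * (A * (G * Aᵀ) * A - A) = 0)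
    exact sub_eq_zero.1 this
  · calc G * Aᵀ * A * (G * Aᵀ) = (G * (Aᵀ * A) * G) * Aᵀ := by simp only [Matrix.mul_assoc]
      _ = G * Aᵀ := by rw [h2]
  · simp [transpose_mul, hGT, Matrix.mul_assoc]
  · have : G * Aᵀ * A = G * (Aᵀ * A) := by simp only [Matrix.mul_assoc]
    rw [this, transpose_mul, hGT, transpose_mul, transpose_transpose, h3]

/-- The Penrose equations have at most one solution. -/
theorem IsMoorePenrose.unique {n p : ℕ} {A : Matrix (Fin n) (Fin p) ℝ}
    {B C : Matrix (Fin p) (Fin n) ℝ} (hB : IsMoorePenrose A B) (hC : IsMoorePenrose A C) :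
    B = C := by
  have h1 : A * B = A * C := by
    calc A * B = (A * C * A) * B := by rw [hC.mul_mul_left]
      _ = (A * C)ᵀ * (A * B)ᵀ := by
          rw [hC.symm_left, hB.symm_left]; simp only [Matrix.mul_assoc]
      _ = (A * B * A * C)ᵀ := by rw [← transpose_mul]; simp only [Matrix.mul_assoc]
      _ = A * C := by rw [hB.mul_mul_left, hC.symm_left]
  have h2 : B * A = C * A := by
    calc B * A = B * (A * C * A) := by rw [hC.mul_mul_left]
      _ = (B * A)ᵀ * (C * A)ᵀ := by
          rw [hC.symm_right, hB.symm_right]; simp only [Matrix.mul_assoc]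
      _ = (C * (A * B * A))ᵀ := by rw [← transpose_mul]; simp only [Matrix.mul_assoc]
      _ = C * A := by rw [hB.mul_mul_left, hC.symm_right]
  calc B = B * A * B := hB.mul_mul_right.symm
    _ = C * (A * B) := by rw [h2, Matrix.mul_assoc]
    _ = C := by rw [h1, ← Matrix.mul_assoc, hC.mul_mul_right]

/-- The Moore–Penrose inverse `A†`. -/
def pinv {n p : ℕ} (A : Matrix (Fin n) (Fin p) ℝ) : Matrix (Fin p) (Fin n) ℝ :=
  (exists_isMoorePenrose A).choose

theorem pinv_spec {n p : ℕ} (A : Matrix (Fin n) (Fin p) ℝ) : IsMoorePenrose A (pinv A) :=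
  (exists_isMoorePenrose A).choose_spec

/-! ### Views of an agent

A view is a bijection `e : Fin p ⊕ Fin q ≃ Fin d`: the agent sees the `p` coordinates
`e (inl a)` and does not see the `q = d - p` coordinates `e (inr b)`. -/

section View

variable {d p q : ℕ} (e : Fin p ⊕ Fin q ≃ Fin d)

/-- The permutation matrix `Π`, with the rows of `Π₊` above the rows of `Π₋`. -/
def permMat : Matrix (Fin p ⊕ Fin q) (Fin d) ℝ :=
  Matrix.of fun a k => if e a = k then 1 else 0

/-- `Π₊`, the rows of `Π` for the observed coordinates. -/
def seen : Matrix (Fin p) (Fin d) ℝ := (permMat e).toRows₁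

/-- `Π₋`, the rows of `Π` for the unobserved coordinates. -/
def unseen : Matrix (Fin q) (Fin d) ℝ := (permMat e).toRows₂

/-- `S₊ = Π₊ S Π₊ᵀ`. -/
def blockPlus (S : Matrix (Fin d) (Fin d) ℝ) : Matrix (Fin p) (Fin p) ℝ :=
  seen e * S * (seen e)ᵀ

/-- `S± = Π₊ S Π₋ᵀ`. -/
def blockPlusMinus (S : Matrix (Fin d) (Fin d) ℝ) : Matrix (Fin p) (Fin q) ℝ :=
  seen e * S * (unseen e)ᵀ

/-- `S∓ = Π₋ S Π₊ᵀ`. -/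
def blockMinusPlus (S : Matrix (Fin d) (Fin d) ℝ) : Matrix (Fin q) (Fin p) ℝ :=
  unseen e * S * (seen e)ᵀ

/-- `T = [ I   S₊⁻¹ S± ] Π`. -/
def T (S : Matrix (Fin d) (Fin d) ℝ) : Matrix (Fin p) (Fin d) ℝ :=
  Matrix.fromCols (1 : Matrix (Fin p) (Fin p) ℝ) ((blockPlus e S)⁻¹ * blockPlusMinus e S) *
    permMat e

/-- `z₊ = x₋ - S∓ S₊⁻¹ x₊`. -/
def residual (S : Matrix (Fin d) (Fin d) ℝ) (x : Fin d → ℝ) : Fin q → ℝ :=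
  unseen e *ᵥ x - (blockMinusPlus e S * (blockPlus e S)⁻¹) *ᵥ (seen e *ᵥ x)

/-- The local least squares estimate `X₊† y`, where `X₊ = X Π₊ᵀ`. -/
def localOLS {n : ℕ} (X : Matrix (Fin n) (Fin d) ℝ) (y : Fin n → ℝ) : Fin p → ℝ :=
  pinv (X * (seen e)ᵀ) *ᵥ y

end View

/-! ### Population quantities -/

/-- The covariance matrix of a distribution `P` on `ℝᵈ`. -/
def covMat {d : ℕ} (P : Measure (Fin d → ℝ)) : Matrix (Fin d) (Fin d) ℝ :=
  Matrix.of fun k l => cov[fun x => x k, fun x => x l; P]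

/-- The matrix `E[x₊ θ₋ᵀ z₊ z₊ᵀ θ₋ x₊ᵀ]`, with `x ∼ P`. -/
def crossMoment {d p q : ℕ} (e : Fin p ⊕ Fin q ≃ Fin d) (P : Measure (Fin d → ℝ))
    (θ : Fin d → ℝ) : Matrix (Fin p) (Fin p) ℝ :=
  Matrix.of fun k l => ∫ x,
    (seen e *ᵥ x) k * ((unseen e *ᵥ θ) ⬝ᵥ residual e (covMat P) x) *
      (residual e (covMat P) x ⬝ᵥ (unseen e *ᵥ θ)) * (seen e *ᵥ x) l ∂P

/-- `W⋆ = Σ₊ (E[x₊ θ₋ᵀ z₊ z₊ᵀ θ₋ x₊ᵀ] + σ² Σ₊)⁻¹ Σ₊`. -/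
def optWeight {d p q : ℕ} (e : Fin p ⊕ Fin q ≃ Fin d) (P : Measure (Fin d → ℝ))
    (θ : Fin d → ℝ) (σ : ℝ) : Matrix (Fin p) (Fin p) ℝ :=
  blockPlus e (covMat P) *
    (crossMoment e P θ + σ ^ 2 • blockPlus e (covMat P))⁻¹ *
    blockPlus e (covMat P)

/-! ### Weighted aggregation -/

section Aggregation

variable {m d : ℕ} {p q : Fin m → ℕ} (e : ∀ i, Fin (p i) ⊕ Fin (q i) ≃ Fin d)
  (S : Matrix (Fin d) (Fin d) ℝ) (W : ∀ i, Matrix (Fin (p i)) (Fin (p i)) ℝ)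
  (θloc : ∀ i, Fin (p i) → ℝ)

/-- The objective `t ↦ ∑ᵢ ‖t₊ + S₊⁻¹ S± t₋ - θlocᵢ‖²` with the squared norm `v ↦ vᵀ Wᵢ v`. -/
def aggObjective (t : Fin d → ℝ) : ℝ :=
  ∑ i, (seen (e i) *ᵥ t +
      ((blockPlus (e i) S)⁻¹ * blockPlusMinus (e i) S) *ᵥ (unseen (e i) *ᵥ t) - θloc i) ⬝ᵥ
    (W i *ᵥ (seen (e i) *ᵥ t +
      ((blockPlus (e i) S)⁻¹ * blockPlusMinus (e i) S) *ᵥ (unseen (e i) *ᵥ t) - θloc i))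

/-- The weighted aggregation: a minimizer of the objective over `ℝᵈ`. -/
def aggregate : Fin d → ℝ :=
  Classical.epsilon fun t => IsMinOn (aggObjective e S W θloc) Set.univ t

end Aggregation

/-! ### Data -/

/-- The data matrix whose rows are the first `n` feature vectors. -/
def dataMat {d : ℕ} (n : ℕ) (x : ℕ → Fin d → ℝ) : Matrix (Fin n) (Fin d) ℝ :=
  Matrix.of fun j k => x j k

/-- The labels `y = X θ + ξ` of the first `n` samples. -/
def labels {d : ℕ} (n : ℕ) (θ : Fin d → ℝ) (x : ℕ → Fin d → ℝ) (ξ : ℕ → ℝ) : Fin n → ℝ :=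
  fun j => (dataMat n x *ᵥ θ) j + ξ j

/-- The local estimates of the agents from `n` samples each. -/
def localEstimates {m d : ℕ} {p q : Fin m → ℕ} (e : ∀ i, Fin (p i) ⊕ Fin (q i) ≃ Fin d)
    (θ : Fin d → ℝ) (n : ℕ) (x : Fin m → ℕ → Fin d → ℝ) (ξ : Fin m → ℕ → ℝ)
    (i : Fin m) : Fin (p i) → ℝ :=
  localOLS (e i) (dataMat n (x i)) (labels n θ (x i) (ξ i))

end Collab

end

namespace Collab

open scoped Topology

/-! Write `T = [I  Σ₊⁻¹Σ±] Π`. Regressing a label on the features seen by an agent splits it as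
`y = x₊ᵀ(Tθ) + (θ₋ᵀz₊ + ξ)`, where `z₊` is uncorrelated with `x₊`. As soon as the empirical second
moment matrix of `x₊` is invertible, the error `θ̂ - Tθ` of the local estimate is therefore its
inverse times the empirical mean of the scores `(θ₋ᵀz₊ + ξ) x₊`. These are centered, and
independent across samples and agents, so the law of large numbers, the central limit theorem and
Slutsky's theorem make the stacked local estimates jointly asymptotically normal, with a block
diagonal covariance matrix `V`.

The aggregated estimate is the weighted least squares solution for the stacked matrices `Tᵢ`, hence
`G θ̂` for a matrix `G` with `G T = 1`, and its limit covariance matrix is `G V Gᵀ`. By the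
Gauss–Markov theorem this is smallest when the weights are the blocks of `V⁻¹`, which are the `Wᵢ⋆`.
-/

section WeightedLeastSquares

variable {m n : Type*} {A : Matrix m n ℝ} {W V : Matrix m m ℝ} {G : Matrix n m ℝ}

theorem isSymm_of_posDef (hW : W.PosDef) : W.IsSymm :=
  isHermitian_iff_isSymm.1 hW.isHermitian

variable [Fintype m]

theorem isUnit_det_of_posDef [DecidableEq m] (hW : W.PosDef) : IsUnit W.det :=
  hW.det_pos.ne'.isUnit

theorem posSemidef_mul_mul_transpose [Finite n] (hV : V.PosSemidef) (B : Matrix n m ℝ) :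
    (B * V * Bᵀ).PosSemidef := by
  simpa only [conjTranspose_eq_transpose_of_trivial] using hV.mul_mul_conjTranspose_same B

variable [Fintype n]

theorem posDef_transpose_mul_mul (hW : W.PosDef) (hA : Function.Injective A.mulVec) :
    (Aᵀ * W * A).PosDef := by
  simpa only [conjTranspose_eq_transpose_of_trivial] using hW.conjTranspose_mul_mul_same hA

theorem dotProduct_transpose_mul_mul_mulVec (A : Matrix m n ℝ) (W : Matrix m m ℝ) (s t : n → ℝ) :
    s ⬝ᵥ ((Aᵀ * W * A) *ᵥ t) = (A *ᵥ s) ⬝ᵥ (W *ᵥ (A *ᵥ t)) := by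
  rw [← mulVec_mulVec, ← mulVec_mulVec, dotProduct_mulVec, vecMul_transpose]

variable [DecidableEq n]

/-- The matrix `(AᵀWA)⁻¹AᵀW` of the weighted least squares estimator, which maps a vector of
observations `b` to the minimizer `t` of `(At - b)ᵀW(At - b)`. -/
noncomputable def wlsGain (A : Matrix m n ℝ) (W : Matrix m m ℝ) : Matrix n m ℝ :=
  (Aᵀ * W * A)⁻¹ * (Aᵀ * W)

theorem wlsGain_mul (hH : (Aᵀ * W * A).PosDef) : wlsGain A W * A = 1 := by
  rw [wlsGain, Matrix.mul_assoc, nonsing_inv_mul _ (isUnit_det_of_posDef hH)]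

theorem transpose_mul_mulVec_wls_residual (hH : (Aᵀ * W * A).PosDef) (b : m → ℝ) :
    Aᵀ *ᵥ (W *ᵥ (A *ᵥ (wlsGain A W *ᵥ b) - b)) = 0 := by
  simp only [wlsGain, mulVec_sub, mulVec_mulVec, ← Matrix.mul_assoc]
  rw [mul_nonsing_inv _ (isUnit_det_of_posDef hH), Matrix.one_mul, sub_self]

theorem weightedSq_eq_wlsGain_add (hW : W.IsSymm) (hH : (Aᵀ * W * A).PosDef) (b : m → ℝ)
    (t : n → ℝ) :
    (A *ᵥ t - b) ⬝ᵥ (W *ᵥ (A *ᵥ t - b)) =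
      (A *ᵥ (wlsGain A W *ᵥ b) - b) ⬝ᵥ (W *ᵥ (A *ᵥ (wlsGain A W *ᵥ b) - b)) +
        (t - wlsGain A W *ᵥ b) ⬝ᵥ ((Aᵀ * W * A) *ᵥ (t - wlsGain A W *ᵥ b)) := by
  have orthogonal : ∀ s, (A *ᵥ s) ⬝ᵥ (W *ᵥ (A *ᵥ (wlsGain A W *ᵥ b) - b)) = 0 := fun s => by
    rw [← vecMul_transpose, ← dotProduct_mulVec, transpose_mul_mulVec_wls_residual hH,
      dotProduct_zero]
  have symm : ∀ u v, u ⬝ᵥ (W *ᵥ v) = v ⬝ᵥ (W *ᵥ u) := fun u v => by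
    rw [dotProduct_mulVec, ← mulVec_transpose, hW.eq, dotProduct_comm]
  have split : A *ᵥ t - b = (A *ᵥ (wlsGain A W *ᵥ b) - b) + A *ᵥ (t - wlsGain A W *ᵥ b) := by
    rw [mulVec_sub]
    abel
  rw [dotProduct_transpose_mul_mul_mulVec, split, mulVec_add, add_dotProduct, dotProduct_add,
    dotProduct_add, orthogonal, symm _ (A *ᵥ (t - _)), orthogonal]
  ring

theorem isMinOn_weightedSq_iff (hW : W.IsSymm) (hH : (Aᵀ * W * A).PosDef) (b : m → ℝ) (t : n → ℝ) :
    IsMinOn (fun s => (A *ᵥ s - b) ⬝ᵥ (W *ᵥ (A *ᵥ s - b))) Set.univ t ↔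
      t = wlsGain A W *ᵥ b := by
  rw [isMinOn_univ_iff]
  constructor
  · intro hmin
    by_contra hne
    have hle := hmin (wlsGain A W *ᵥ b)
    rw [weightedSq_eq_wlsGain_add hW hH b t] at hle
    have hpos := hH.dotProduct_mulVec_pos (sub_ne_zero.2 hne)
    rw [star_trivial] at hpos
    linarith
  · rintro rfl s
    rw [weightedSq_eq_wlsGain_add hW hH b s]
    exact le_add_of_nonneg_right (by
      simpa only [star_trivial] using
        hH.posSemidef.dotProduct_mulVec_nonneg (s - wlsGain A W *ᵥ b))

variable [DecidableEq m]

theorem mul_mul_transpose_wlsGain_inv (hV : V.PosDef) (hG : G * A = 1) :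
    G * V * (wlsGain A V⁻¹)ᵀ = (Aᵀ * V⁻¹ * A)⁻¹ := by
  have hVs := isSymm_of_posDef hV
  rw [wlsGain, transpose_mul, transpose_mul, transpose_nonsing_inv, transpose_nonsing_inv,
    transpose_transpose, transpose_mul, transpose_mul, transpose_nonsing_inv, transpose_transpose,
    hVs.eq]
  calc G * V * (V⁻¹ * A * (Aᵀ * (V⁻¹ * A))⁻¹)
      = G * (V * V⁻¹ * A) * (Aᵀ * V⁻¹ * A)⁻¹ := by simp only [Matrix.mul_assoc]
    _ = (Aᵀ * V⁻¹ * A)⁻¹ := by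
      rw [mul_nonsing_inv _ (isUnit_det_of_posDef hV), Matrix.one_mul, hG, Matrix.one_mul]

/-- **Gauss–Markov theorem**. -/
theorem posSemidef_mul_mul_transpose_sub_inv (hV : V.PosDef) (hH : (Aᵀ * V⁻¹ * A).PosDef)
    (hG : G * A = 1) : (G * V * Gᵀ - (Aᵀ * V⁻¹ * A)⁻¹).PosSemidef := by
  have hcross := mul_mul_transpose_wlsGain_inv hV hG
  have hcross' : wlsGain A V⁻¹ * V * Gᵀ = (Aᵀ * V⁻¹ * A)⁻¹ := by
    rw [← (isSymm_of_posDef hH.inv).eq, ← hcross]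
    simp only [transpose_mul, transpose_transpose, (isSymm_of_posDef hV).eq, Matrix.mul_assoc]
  have hdiff : G * V * Gᵀ - (Aᵀ * V⁻¹ * A)⁻¹ =
      (G - wlsGain A V⁻¹) * V * (G - wlsGain A V⁻¹)ᵀ := by
    rw [transpose_sub, Matrix.mul_sub, Matrix.sub_mul, Matrix.sub_mul, Matrix.sub_mul, hcross,
      hcross', mul_mul_transpose_wlsGain_inv hV (wlsGain_mul hH), sub_self, sub_zero]
  rw [hdiff]
  exact posSemidef_mul_mul_transpose hV.posSemidef _

end WeightedLeastSquares

section Blocks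

variable {ι n R : Type*} {k : ι → Type*}

/-- The block column with blocks `A i`, the counterpart of `Matrix.fromRows` for a family of
matrices. -/
def stackRows (A : ∀ i, Matrix (k i) n R) : Matrix (Σ i, k i) n R :=
  Matrix.of fun s => A s.1 s.2

variable [Fintype ι] [DecidableEq ι] [∀ i, Fintype (k i)]

theorem blockDiagonal'_mulVec [NonUnitalNonAssocSemiring R] (W : ∀ i, Matrix (k i) (k i) R)
    (v : (Σ i, k i) → R) :
    blockDiagonal' W *ᵥ v = fun s => (W s.1 *ᵥ fun a => v ⟨s.1, a⟩) s.2 := by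
  ext ⟨i, a⟩
  rw [mulVec, dotProduct, Fintype.sum_sigma, Finset.sum_eq_single i]
  · simp only [blockDiagonal'_apply_eq, mulVec, dotProduct]
  · intro j _ hj
    simp only [blockDiagonal'_apply_ne _ _ _ hj.symm, zero_mul, Finset.sum_const_zero]
  · exact fun h => absurd (Finset.mem_univ i) h

theorem transpose_stackRows_mul_blockDiagonal'_mul [Semiring R] (A : ∀ i, Matrix (k i) n R)
    (W : ∀ i, Matrix (k i) (k i) R) :
    (stackRows A)ᵀ * blockDiagonal' W * stackRows A = ∑ i, (A i)ᵀ * W i * A i := by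
  ext a b
  rw [Matrix.mul_assoc, Matrix.mul_apply, Fintype.sum_sigma, Matrix.sum_apply]
  refine Finset.sum_congr rfl fun i _ => ?_
  rw [Matrix.mul_assoc, Matrix.mul_apply]
  refine Finset.sum_congr rfl fun c _ => ?_
  exact congrArg (A i c a * ·) (congrFun (blockDiagonal'_mulVec W fun s => A s.1 s.2 b) ⟨i, c⟩)

omit [Fintype ι] [∀ i, Fintype (k i)] in
theorem posDef_blockDiagonal' [Finite ι] [∀ i, Finite (k i)] {W : ∀ i, Matrix (k i) (k i) ℝ}
    (hW : ∀ i, (W i).PosDef) : (blockDiagonal' W).PosDef := by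
  have := Fintype.ofFinite ι
  have := fun i => Fintype.ofFinite (k i)
  refine PosDef.of_dotProduct_mulVec_pos ?_ fun v hv => ?_
  · rw [IsHermitian, blockDiagonal'_conjTranspose]
    exact congrArg blockDiagonal' (funext fun i => (hW i).isHermitian)
  · obtain ⟨⟨i, a⟩, hia⟩ := Function.ne_iff.1 hv
    rw [blockDiagonal'_mulVec, dotProduct, Fintype.sum_sigma]
    refine Finset.sum_pos' (fun j _ => ?_) ⟨i, Finset.mem_univ i, ?_⟩
    · exact (hW j).posSemidef.dotProduct_mulVec_nonneg fun b => v ⟨j, b⟩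
    · exact (hW i).dotProduct_mulVec_pos (x := fun b => v ⟨i, b⟩) (Function.ne_iff.2 ⟨a, hia⟩)

theorem inv_blockDiagonal' [CommRing R] [∀ i, DecidableEq (k i)] {W : ∀ i, Matrix (k i) (k i) R}
    (hW : ∀ i, IsUnit (W i).det) : (blockDiagonal' W)⁻¹ = blockDiagonal' fun i => (W i)⁻¹ := by
  refine inv_eq_left_inv ?_
  rw [← blockDiagonal'_mul, ← blockDiagonal'_one]
  exact congrArg blockDiagonal' (funext fun i => nonsing_inv_mul _ (hW i))

end Blocks

section Views

variable {d p q : ℕ} (e : Fin p ⊕ Fin q ≃ Fin d) {S : Matrix (Fin d) (Fin d) ℝ}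

theorem seen_mulVec (v : Fin d → ℝ) (a : Fin p) : (seen e *ᵥ v) a = v (e (Sum.inl a)) := by
  simp [seen, permMat, mulVec, dotProduct, toRows₁]

theorem fromRows_seen_unseen : fromRows (seen e) (unseen e) = permMat e :=
  fromRows_toRows _

theorem permMat_eq_submatrix_one :
    permMat e = (1 : Matrix (Fin d) (Fin d) ℝ).submatrix e id := by
  ext a k
  simp [permMat, Matrix.one_apply]

theorem seen_eq_submatrix_one :
    seen e = (1 : Matrix (Fin d) (Fin d) ℝ).submatrix (e ∘ Sum.inl) id := by
  rw [seen, permMat_eq_submatrix_one]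
  rfl

theorem transpose_seen_mul_seen_add :
    (seen e)ᵀ * seen e + (unseen e)ᵀ * unseen e = 1 := by
  rw [← fromCols_mul_fromRows, ← transpose_fromRows, fromRows_seen_unseen,
    permMat_eq_submatrix_one, transpose_submatrix, submatrix_mul_equiv, transpose_one,
    Matrix.one_mul, submatrix_id_id]

theorem blockPlus_eq_submatrix (S : Matrix (Fin d) (Fin d) ℝ) :
    blockPlus e S = S.submatrix (e ∘ Sum.inl) (e ∘ Sum.inl) := by
  ext a b
  simp [blockPlus, seen_eq_submatrix_one, Matrix.mul_apply, Matrix.one_apply]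

theorem blockPlus_posDef (hS : S.PosDef) : (blockPlus e S).PosDef := by
  rw [blockPlus_eq_submatrix]
  exact hS.submatrix (e.injective.comp Sum.inl_injective)

theorem T_eq_seen_add (S : Matrix (Fin d) (Fin d) ℝ) :
    T e S = seen e + (blockPlus e S)⁻¹ * blockPlusMinus e S * unseen e := by
  rw [T, ← fromRows_seen_unseen, fromCols_mul_fromRows, Matrix.one_mul]

theorem T_mulVec (S : Matrix (Fin d) (Fin d) ℝ) (t : Fin d → ℝ) :
    T e S *ᵥ t =
      seen e *ᵥ t + ((blockPlus e S)⁻¹ * blockPlusMinus e S) *ᵥ (unseen e *ᵥ t) := by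
  rw [T_eq_seen_add, add_mulVec, mulVec_mulVec]

theorem blockPlus_mul_T (hS : S.PosDef) : blockPlus e S * T e S = seen e * S := by
  have hu := isUnit_det_of_posDef (blockPlus_posDef e hS)
  calc blockPlus e S * T e S
      = seen e * S * ((seen e)ᵀ * seen e + (unseen e)ᵀ * unseen e) := by
        rw [T_eq_seen_add, Matrix.mul_add, Matrix.mul_assoc (blockPlus e S)⁻¹,
          mul_nonsing_inv_cancel_left _ _ hu, Matrix.mul_add, blockPlus, blockPlusMinus]
        simp only [Matrix.mul_assoc]
    _ = seen e * S := by rw [transpose_seen_mul_seen_add, Matrix.mul_one]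

theorem blockPlus_isSymm (hS : S.IsSymm) : (blockPlus e S).IsSymm := by
  rw [IsSymm, blockPlus, transpose_mul, transpose_mul, transpose_transpose, hS.eq,
    Matrix.mul_assoc]

theorem transpose_blockMinusPlus (hS : S.IsSymm) :
    (blockMinusPlus e S)ᵀ = blockPlusMinus e S := by
  rw [blockMinusPlus, blockPlusMinus, transpose_mul, transpose_mul, transpose_transpose, hS.eq,
    Matrix.mul_assoc]

theorem unseen_dotProduct_residual (hS : S.IsSymm) (x θ : Fin d → ℝ) :
    (unseen e *ᵥ θ) ⬝ᵥ residual e S x = x ⬝ᵥ ((1 - (seen e)ᵀ * T e S) *ᵥ θ) := by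
  have hcoeff : (unseen e - blockMinusPlus e S * (blockPlus e S)⁻¹ * seen e)ᵀ * unseen e =
      1 - (seen e)ᵀ * T e S := by
    rw [transpose_sub, transpose_mul, transpose_mul, transpose_nonsing_inv,
      (blockPlus_isSymm e hS).eq, transpose_blockMinusPlus e hS, T_eq_seen_add, Matrix.mul_add,
      ← transpose_seen_mul_seen_add e, Matrix.sub_mul, add_sub_add_left_eq_sub]
    simp only [Matrix.mul_assoc]
  rw [← hcoeff, residual, mulVec_mulVec, ← sub_mulVec, ← mulVec_mulVec, dotProduct_mulVec x,
    vecMul_transpose, dotProduct_comm]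

theorem dotProduct_eq_seen_add_residual (hS : S.IsSymm) (x θ : Fin d → ℝ) :
    x ⬝ᵥ θ = (seen e *ᵥ x) ⬝ᵥ (T e S *ᵥ θ) + (unseen e *ᵥ θ) ⬝ᵥ residual e S x := by
  rw [unseen_dotProduct_residual e hS, sub_mulVec, one_mulVec, dotProduct_sub,
    ← mulVec_mulVec, dotProduct_mulVec x (seen e)ᵀ, vecMul_transpose, add_sub_cancel]

end Views

section Aggregation

variable {m d : ℕ} {p q : Fin m → ℕ} (e : ∀ i, Fin (p i) ⊕ Fin (q i) ≃ Fin d)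
  {S : Matrix (Fin d) (Fin d) ℝ} {W : ∀ i, Matrix (Fin (p i)) (Fin (p i)) ℝ}

/-- The matrix that stacks the matrices `Tᵢ` of all agents. It maps `t` to the vector of all
local parameters that `t` induces, which the local estimates approximate. -/
noncomputable def jointT (S : Matrix (Fin d) (Fin d) ℝ) : Matrix (Σ i, Fin (p i)) (Fin d) ℝ :=
  stackRows fun i => T (e i) S

theorem jointT_mulVec_injective
    (hcover : ∀ k : Fin d, ∃ (i : Fin m) (a : Fin (p i)), e i (Sum.inl a) = k) (hS : S.PosDef) :
    Function.Injective (jointT e S).mulVec := by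
  refine (injective_iff_map_eq_zero (jointT e S).mulVecLin).2 fun t ht => ?_
  have hT : ∀ i, T (e i) S *ᵥ t = 0 := fun i => funext fun a => congrFun ht ⟨i, a⟩
  have hSt : S *ᵥ t = 0 := by
    funext k
    obtain ⟨i, a, rfl⟩ := hcover k
    rw [← seen_mulVec (e i) (S *ᵥ t) a, mulVec_mulVec, ← blockPlus_mul_T (e i) hS, ← mulVec_mulVec,
      hT, mulVec_zero]
    rfl
  exact mulVec_injective_iff_isUnit.2 hS.isUnit (hSt.trans (mulVec_zero S).symm)

theorem posDef_jointT_normalMatrix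
    (hcover : ∀ k : Fin d, ∃ (i : Fin m) (a : Fin (p i)), e i (Sum.inl a) = k) (hS : S.PosDef)
    (hW : ∀ i, (W i).PosDef) : ((jointT e S)ᵀ * blockDiagonal' W * jointT e S).PosDef :=
  posDef_transpose_mul_mul (posDef_blockDiagonal' hW) (jointT_mulVec_injective e hcover hS)

theorem aggObjective_eq (θloc : ∀ i, Fin (p i) → ℝ) (t : Fin d → ℝ) :
    aggObjective e S W θloc t = (jointT e S *ᵥ t - fun s => θloc s.1 s.2) ⬝ᵥ
      (blockDiagonal' W *ᵥ (jointT e S *ᵥ t - fun s => θloc s.1 s.2)) := by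
  rw [blockDiagonal'_mulVec, dotProduct, Fintype.sum_sigma, aggObjective]
  simp only [← T_mulVec]
  rfl

theorem isMinOn_aggObjective_iff_wlsGain (hW : ∀ i, (W i).PosDef)
    (hH : ((jointT e S)ᵀ * blockDiagonal' W * jointT e S).PosDef)
    (θloc : ∀ i, Fin (p i) → ℝ) (t : Fin d → ℝ) :
    IsMinOn (aggObjective e S W θloc) Set.univ t ↔
      t = wlsGain (jointT e S) (blockDiagonal' W) *ᵥ fun s => θloc s.1 s.2 := by
  rw [funext (aggObjective_eq e θloc)]
  exact isMinOn_weightedSq_iff (isSymm_of_posDef (posDef_blockDiagonal' hW)) hH _ t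

theorem aggregate_eq (hW : ∀ i, (W i).PosDef)
    (hH : ((jointT e S)ᵀ * blockDiagonal' W * jointT e S).PosDef) (θloc : ∀ i, Fin (p i) → ℝ) :
    aggregate e S W θloc =
      wlsGain (jointT e S) (blockDiagonal' W) *ᵥ fun s => θloc s.1 s.2 := by
  have hiff := isMinOn_aggObjective_iff_wlsGain e hW hH θloc
  exact (hiff _).1 (Classical.epsilon_spec
    (p := fun t => IsMinOn (aggObjective e S W θloc) Set.univ t) ⟨_, (hiff _).2 rfl⟩)

theorem isMinOn_aggObjective_iff
    (hcover : ∀ k : Fin d, ∃ (i : Fin m) (a : Fin (p i)), e i (Sum.inl a) = k) (hS : S.PosDef)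
    (hW : ∀ i, (W i).PosDef) (θloc : ∀ i, Fin (p i) → ℝ) (t : Fin d → ℝ) :
    IsMinOn (aggObjective e S W θloc) Set.univ t ↔ t = aggregate e S W θloc := by
  have hH := posDef_jointT_normalMatrix e hcover hS hW
  rw [isMinOn_aggObjective_iff_wlsGain e hW hH, aggregate_eq e hW hH]

end Aggregation

section Independence

variable {ι κ Ω 𝓧 : Type*} [MeasurableSpace Ω] [MeasurableSpace 𝓧] {μ : Measure Ω}

theorem iIndepFun_curry [IsProbabilityMeasure μ] [Countable ι] [Countable κ]
    {X : ι → κ → Ω → 𝓧} (hX : ∀ j i, AEMeasurable (X j i) μ)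
    (h : iIndepFun (fun (a : ι × κ) ω => X a.1 a.2 ω) μ) :
    iIndepFun (fun j ω i => X j i ω) μ := by
  have hprob : ∀ j i, IsProbabilityMeasure (μ.map (X j i)) := fun j i =>
    Measure.isProbabilityMeasure_map (hX j i)
  have hrow : ∀ j, AEMeasurable (fun ω i => X j i ω) μ := fun j => aemeasurable_pi_iff.2 (hX j)
  have hall : AEMeasurable (fun ω (a : ι × κ) => X a.1 a.2 ω) μ :=
    aemeasurable_pi_iff.2 fun a => hX a.1 a.2
  have row_law : ∀ j, μ.map (fun ω i => X j i ω) = Measure.infinitePi fun i => μ.map (X j i) :=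
    fun j => (h.precomp (g := fun i => (j, i)) (Prod.mk_right_injective j)
      ).map_fun_eq_infinitePi_map₀' (hX j)
  have joint_law := h.map_fun_eq_infinitePi_map₀' (fun a : ι × κ => hX a.1 a.2)
  rw [iIndepFun_iff_map_fun_eq_infinitePi_map₀' hrow]
  simp_rw [row_law]
  rw [← Measure.infinitePi_map_curry fun j i => μ.map (X j i), ← joint_law,
    AEMeasurable.map_map_of_aemeasurable (MeasurableEquiv.measurable _).aemeasurable hall]
  rfl

theorem identDistrib_pi [Countable κ] {X Y : κ → Ω → 𝓧} (hX : iIndepFun X μ) (hY : iIndepFun Y μ)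
    (h : ∀ i, IdentDistrib (X i) (Y i) μ μ) :
    IdentDistrib (fun ω i => X i ω) (fun ω i => Y i ω) μ μ where
  aemeasurable_fst := aemeasurable_pi_iff.2 fun i => (h i).aemeasurable_fst
  aemeasurable_snd := aemeasurable_pi_iff.2 fun i => (h i).aemeasurable_snd
  map_eq := by
    rw [hX.map_fun_eq_infinitePi_map₀' fun i => (h i).aemeasurable_fst,
      hY.map_fun_eq_infinitePi_map₀' fun i => (h i).aemeasurable_snd]
    simp_rw [fun i => (h i).map_eq]

end Independence

section Covariance

variable {Ω ι : Type*} [MeasurableSpace Ω] {μ : Measure Ω}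

/-- The covariance matrix of a family of real random variables. -/
noncomputable def covMatrix (X : ι → Ω → ℝ) (μ : Measure Ω) : Matrix ι ι ℝ :=
  Matrix.of fun k l => cov[X k, X l; μ]

theorem covMatrix_sigma [IsProbabilityMeasure μ] [DecidableEq ι] {k : ι → Type*}
    {X : (Σ i, k i) → Ω → ℝ} (hX : ∀ s, MemLp (X s) 2 μ)
    (hindep : ∀ i j, i ≠ j → ∀ a b, IndepFun (X ⟨i, a⟩) (X ⟨j, b⟩) μ) :
    covMatrix X μ = blockDiagonal' fun i => covMatrix (fun a => X ⟨i, a⟩) μ := by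
  ext ⟨i, a⟩ ⟨j, b⟩
  by_cases hij : i = j
  · subst hij
    rw [blockDiagonal'_apply_eq]
    rfl
  · rw [blockDiagonal'_apply_ne _ _ _ hij]
    exact (hindep i j hij a b).covariance_eq_zero (hX _) (hX _)

variable [IsFiniteMeasure μ] [Fintype ι] {X : ι → Ω → ℝ}

theorem variance_dotProduct (hX : ∀ k, MemLp (X k) 2 μ) (t : ι → ℝ) :
    Var[fun ω => t ⬝ᵥ fun k => X k ω; μ] = t ⬝ᵥ (covMatrix X μ *ᵥ t) := by
  simp only [dotProduct]
  rw [variance_fun_sum fun k => (hX k).const_mul (t k)]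
  simp only [mulVec, dotProduct, covMatrix, of_apply, covariance_const_mul_left,
    covariance_const_mul_right, Finset.mul_sum]
  exact Finset.sum_congr rfl fun i _ => Finset.sum_congr rfl fun j _ => by ring

omit [Fintype ι] in
theorem covMatrix_posSemidef [Finite ι] (hX : ∀ k, MemLp (X k) 2 μ) :
    (covMatrix X μ).PosSemidef := by
  have := Fintype.ofFinite ι
  refine PosSemidef.of_dotProduct_mulVec_nonneg ?_ fun t => ?_
  · exact ext fun k l => covariance_comm _ _
  · rw [star_trivial, ← variance_dotProduct hX]
    exact variance_nonneg _ _

end Covariance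

section ConvergenceInDistribution

variable {Ω Ω' E : Type*} [MeasurableSpace Ω] [MeasurableSpace Ω'] [MeasurableSpace E]
  {μ : Measure Ω}

theorem charFun_map_inner [NormedAddCommGroup E] [InnerProductSpace ℝ E]
    [SecondCountableTopology E] [BorelSpace E] {V : Ω → E} (hV : AEMeasurable V μ) (t : E) :
    charFun (μ.map fun ω => inner ℝ (V ω) t) 1 = charFun (μ.map V) t := by
  have hinner : Measurable fun x : E => inner ℝ x t := by fun_prop
  rw [charFun_apply_real, charFun_apply, integral_map hV (by fun_prop),
    integral_map (φ := fun ω => inner ℝ (V ω) t) (hinner.comp_aemeasurable hV) (by fun_prop)]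
  simp only [Complex.ofReal_one, one_mul]

variable [IsProbabilityMeasure μ] {μ' : Measure Ω'} [IsProbabilityMeasure μ'] {Z : Ω' → E}

theorem tendstoInDistribution_id_of_hasLaw [TopologicalSpace E] [OpensMeasurableSpace E]
    {α : Type*} {l : Filter α} {X : α → Ω → E} {ν : Measure E} [IsProbabilityMeasure ν]
    (h : TendstoInDistribution X l Z (fun _ => μ) μ') (hZ : HasLaw Z ν μ') :
    TendstoInDistribution X l id (fun _ => μ) ν := by
  refine ⟨h.forall_aemeasurable, aemeasurable_id, ?_⟩
  convert h.tendsto using 2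
  exact congrArg 𝓝 (Subtype.ext (Measure.map_id.trans hZ.map_eq.symm))

variable {X Y : ℕ → Ω → E}

theorem tendstoInDistribution_of_ae_eventually_eq [NormedAddCommGroup E]
    [SecondCountableTopology E] [BorelSpace E]
    (h : TendstoInDistribution X atTop Z (fun _ => μ) μ') (hY : ∀ n, AEMeasurable (Y n) μ)
    (hYX : ∀ᵐ ω ∂μ, ∀ᶠ n in atTop, Y n ω = X n ω) :
    TendstoInDistribution Y atTop Z (fun _ => μ) μ' := by
  refine tendstoInDistribution_of_tendstoInMeasure_sub Y Z h ?_ hY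
  refine tendstoInMeasure_of_tendsto_ae
    (fun n => ((hY n).sub (h.forall_aemeasurable n)).aestronglyMeasurable) ?_
  filter_upwards [hYX] with ω hω
  exact tendsto_const_nhds.congr' (hω.mono fun n hn => (sub_eq_zero.2 hn).symm)

/-- The **Cramér–Wold device**. -/
theorem tendstoInDistribution_of_inner [NormedAddCommGroup E] [InnerProductSpace ℝ E]
    [FiniteDimensional ℝ E] [BorelSpace E] (hX : ∀ n, AEMeasurable (X n) μ)
    (hZ : AEMeasurable Z μ')
    (h : ∀ t, TendstoInDistribution (fun n ω => inner ℝ (X n ω) t) atTop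
      (fun ω => inner ℝ (Z ω) t) (fun _ => μ) μ') :
    TendstoInDistribution X atTop Z (fun _ => μ) μ' := by
  refine ⟨hX, hZ, ProbabilityMeasure.tendsto_iff_tendsto_charFun.2 fun t => ?_⟩
  have hproj := ProbabilityMeasure.tendsto_iff_tendsto_charFun.1 (h t).tendsto 1
  simpa only [ProbabilityMeasure.coe_mk, charFun_map_inner (hX _), charFun_map_inner hZ] using hproj

end ConvergenceInDistribution

section MultivariateGaussian

variable {ι κ Ω : Type*} [Fintype ι] [DecidableEq ι] [Fintype κ] [MeasurableSpace Ω]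
  {μ : Measure Ω} [IsProbabilityMeasure μ] {S : Matrix ι ι ℝ}

theorem hasLaw_inner_multivariateGaussian (hS : S.PosSemidef) (c t : EuclideanSpace ℝ ι) :
    HasLaw (fun x => inner ℝ x t)
      (gaussianReal (inner ℝ c t) (t.ofLp ⬝ᵥ (S *ᵥ t.ofLp)).toNNReal)
      (multivariateGaussian c S) := by
  have hinner : Measurable fun x : EuclideanSpace ℝ ι => inner ℝ x t := by fun_prop
  refine ⟨hinner.aemeasurable, ?_⟩
  have nonneg : 0 ≤ t.ofLp ⬝ᵥ (S *ᵥ t.ofLp) := by simpa using hS.dotProduct_mulVec_nonneg t.ofLp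
  have := Measure.isProbabilityMeasure_map (μ := multivariateGaussian c S) hinner.aemeasurable
  refine Measure.ext_of_charFun (funext fun s => ?_)
  have scale : ∀ x, inner ℝ (inner ℝ x t) s = inner ℝ x (s • t) := fun x => by
    simp [real_inner_smul_right]
  rw [charFun_apply, integral_map hinner.aemeasurable (by fun_prop)]
  simp_rw [scale]
  rw [← charFun_apply, charFun_multivariateGaussian hS, charFun_gaussianReal,
    real_inner_smul_left, real_inner_comm, Real.coe_toNNReal _ nonneg]
  congr 1
  simp [mulVec_smul]
  ring

theorem hasLaw_mulVec_multivariateGaussian [DecidableEq κ] (hS : S.PosSemidef)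
    (c : EuclideanSpace ℝ ι) (A : Matrix κ ι ℝ) :
    HasLaw (fun x => (WithLp.toLp 2 (A *ᵥ x.ofLp) : EuclideanSpace ℝ κ))
      (multivariateGaussian (WithLp.toLp 2 (A *ᵥ c.ofLp)) (A * S * Aᵀ))
      (multivariateGaussian c S) := by
  have hA : Measurable fun x : EuclideanSpace ℝ ι => WithLp.toLp 2 (A *ᵥ x.ofLp) := by
    fun_prop
  have := Measure.isProbabilityMeasure_map (μ := multivariateGaussian c S) hA.aemeasurable
  refine ⟨hA.aemeasurable, Measure.ext_of_charFun (funext fun t => ?_)⟩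
  have adjoint : ∀ x : EuclideanSpace ℝ ι, inner ℝ (WithLp.toLp 2 (A *ᵥ x.ofLp)) t =
      inner ℝ x (WithLp.toLp 2 (Aᵀ *ᵥ t.ofLp)) := fun x => by
    simp only [EuclideanSpace.inner_eq_star_dotProduct, star_trivial]
    rw [dotProduct_mulVec, ← mulVec_transpose]
  rw [charFun_apply, integral_map hA.aemeasurable (by fun_prop)]
  simp_rw [adjoint]
  rw [← charFun_apply, charFun_multivariateGaussian hS,
    charFun_multivariateGaussian (posSemidef_mul_mul_transpose hS A), real_inner_comm, ← adjoint,
    real_inner_comm]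
  simp only [← mulVec_mulVec]
  rw [dotProduct_mulVec t.ofLp, ← mulVec_transpose]

/-- The multivariate **central limit theorem** for centered variables. -/
theorem tendstoInDistribution_inv_sqrt_smul_sum {X : ℕ → Ω → EuclideanSpace ℝ ι}
    (hindep : iIndepFun X μ) (hident : ∀ j, IdentDistrib (X j) (X 0) μ μ)
    (hL2 : ∀ k, MemLp (fun ω => X 0 ω k) 2 μ) (hmean : ∀ k, ∫ ω, X 0 ω k ∂μ = 0) :
    TendstoInDistribution (fun (n : ℕ) ω => (√n : ℝ)⁻¹ • ∑ j ∈ Finset.range n, X j ω) atTop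
      (id : EuclideanSpace ℝ ι → EuclideanSpace ℝ ι) (fun _ => μ)
      (multivariateGaussian 0 (covMatrix (fun k ω => X 0 ω k) μ)) := by
  refine tendstoInDistribution_of_inner (fun n => (Finset.aemeasurable_fun_sum _ fun j _ =>
    (hident j).aemeasurable_fst).const_smul (√n : ℝ)⁻¹) aemeasurable_id fun t => ?_
  have hφ : Measurable fun x : EuclideanSpace ℝ ι => inner ℝ x t := by fun_prop
  have inner_eq : ∀ ω, inner ℝ (X 0 ω) t = t.ofLp ⬝ᵥ fun k => X 0 ω k := fun ω => by
    rw [EuclideanSpace.inner_eq_star_dotProduct, star_trivial]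
  have inner_memLp : MemLp (fun ω => inner ℝ (X 0 ω) t) 2 μ := by
    simp only [inner_eq, dotProduct]
    exact memLp_finsetSum _ fun k _ => (hL2 k).const_mul (t k)
  have inner_mean : ∫ ω, inner ℝ (X 0 ω) t ∂μ = 0 := by
    simp only [inner_eq, dotProduct]
    rw [integral_finsetSum _ fun k _ => ((hL2 k).integrable one_le_two).const_mul (t k)]
    simp only [integral_const_mul, hmean, mul_zero, Finset.sum_const_zero]
  have limit_law := hasLaw_inner_multivariateGaussian (covMatrix_posSemidef hL2) 0 t
  rw [inner_zero_left, ← variance_dotProduct hL2] at limit_law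
  simp_rw [← inner_eq] at limit_law
  have clt := tendstoInDistribution_inv_sqrt_mul_sum_sub (X := fun j ω => inner ℝ (X j ω) t)
    limit_law inner_memLp (hindep.comp (fun _ x => inner ℝ x t) fun _ => hφ)
    fun j => (hident j).comp hφ
  simpa only [inner_mean, mul_zero, sub_zero, real_inner_smul_left, sum_inner, id_eq] using clt

/-- **Slutsky's theorem** for a product of random matrices and random vectors. -/
theorem tendstoInDistribution_mulVec [DecidableEq κ] {U : ℕ → Ω → EuclideanSpace ℝ ι}
    {M : ℕ → Ω → κ → ι → ℝ} {M₀ : Matrix κ ι ℝ} {Y : ℕ → Ω → EuclideanSpace ℝ κ}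
    (hS : S.PosSemidef)
    (hU : TendstoInDistribution U atTop id (fun _ => μ) (multivariateGaussian 0 S))
    (hM : ∀ n, AEMeasurable (M n) μ) (hMlim : ∀ᵐ ω ∂μ, Tendsto (M · ω) atTop (𝓝 M₀))
    (hY : ∀ n, AEMeasurable (Y n) μ)
    (hYU : ∀ᵐ ω ∂μ, ∀ᶠ n in atTop, Y n ω = WithLp.toLp 2 (Matrix.of (M n ω) *ᵥ (U n ω).ofLp)) :
    TendstoInDistribution Y atTop id (fun _ => μ) (multivariateGaussian 0 (M₀ * S * M₀ᵀ)) := by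
  have hcont : Continuous fun z : EuclideanSpace ℝ ι × (κ → ι → ℝ) =>
      WithLp.toLp 2 (Matrix.of z.2 *ᵥ z.1.ofLp) := by
    refine (PiLp.continuous_toLp 2 _).comp (Continuous.matrix_mulVec ?_ ?_)
    · exact continuous_snd
    · fun_prop
  have hlim := hU.continuous_comp_prodMk_of_tendstoInMeasure_const hcont
    (tendstoInMeasure_of_tendsto_ae (fun n => (hM n).aestronglyMeasurable) hMlim) hM
  refine tendstoInDistribution_of_ae_eventually_eq ?_ hY hYU
  refine tendstoInDistribution_id_of_hasLaw hlim ?_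
  have law := hasLaw_mulVec_multivariateGaussian hS 0 M₀
  rwa [WithLp.ofLp_zero, mulVec_zero, WithLp.toLp_zero] at law

end MultivariateGaussian

section MatrixInverse

variable {n : Type*} [Fintype n] [DecidableEq n]

theorem measurable_matrix_inv :
    Measurable fun (A : n → n → ℝ) (a b : n) => (Matrix.of A)⁻¹ a b := by
  have hof : Continuous fun A : n → n → ℝ => Matrix.of A := continuous_id
  refine measurable_pi_iff.2 fun a => measurable_pi_iff.2 fun b => ?_
  simp only [inv_def, Ring.inverse_eq_inv', Matrix.smul_apply, smul_eq_mul]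
  exact hof.matrix_det.measurable.inv.mul (hof.matrix_adjugate.matrix_elem a b).measurable

theorem continuousAt_matrix_inv_of_isUnit {A : Matrix n n ℝ} (hA : IsUnit A.det) :
    ContinuousAt Inv.inv A := by
  refine continuousAt_matrix_inv A ?_
  simp only [Ring.inverse_eq_inv']
  exact continuousAt_inv₀ hA.ne_zero

theorem eventually_isUnit_det {α : Type*} {l : Filter α} {A : α → Matrix n n ℝ}
    {A₀ : Matrix n n ℝ} (hA₀ : IsUnit A₀.det) (hA : Tendsto A l (𝓝 A₀)) :
    ∀ᶠ x in l, IsUnit (A x).det :=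
  (((continuous_id.matrix_det.tendsto _).comp hA).eventually_ne hA₀.ne_zero).mono
    fun _ hx => hx.isUnit

theorem tendsto_blockDiagonal' {α ι R : Type*} [DecidableEq ι] [Zero R] [TopologicalSpace R]
    {k : ι → Type*} {l : Filter α} {A : α → ∀ i, Matrix (k i) (k i) R}
    {A₀ : ∀ i, Matrix (k i) (k i) R} (hA : ∀ i, Tendsto (A · i) l (𝓝 (A₀ i))) :
    Tendsto (fun x => blockDiagonal' (A x)) l (𝓝 (blockDiagonal' A₀)) := by
  have hdiag : Continuous fun B : ∀ i, Matrix (k i) (k i) R => blockDiagonal' B :=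
    Continuous.matrix_blockDiagonal' continuous_id
  exact hdiag.continuousAt.tendsto.comp (tendsto_pi_nhds.2 hA)

end MatrixInverse

section MoorePenrose

variable {n p : ℕ}

theorem isClosed_isMoorePenrose :
    IsClosed {z : (Fin n → Fin p → ℝ) × (Fin p → Fin n → ℝ) |
      IsMoorePenrose (Matrix.of z.1) (Matrix.of z.2)} := by
  have hA : Continuous fun z : (Fin n → Fin p → ℝ) × (Fin p → Fin n → ℝ) => Matrix.of z.1 :=
    continuous_fst
  have hB : Continuous fun z : (Fin n → Fin p → ℝ) × (Fin p → Fin n → ℝ) => Matrix.of z.2 :=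
    continuous_snd
  have hAB := hA.matrix_mul hB
  have hBA := hB.matrix_mul hA
  have penrose_iff (A : Matrix (Fin n) (Fin p) ℝ) (B : Matrix (Fin p) (Fin n) ℝ) :
      IsMoorePenrose A B ↔
        A * B * A = A ∧ B * A * B = B ∧ (A * B)ᵀ = A * B ∧ (B * A)ᵀ = B * A :=
    ⟨fun h => ⟨h.1, h.2, h.3, h.4⟩, fun h => ⟨h.1, h.2.1, h.2.2.1, h.2.2.2⟩⟩
  simp only [penrose_iff]
  exact (isClosed_eq (hAB.matrix_mul hA) hA).inter <| (isClosed_eq (hBA.matrix_mul hB) hB).inter <|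
    (isClosed_eq hAB.matrix_transpose hAB).inter (isClosed_eq hBA.matrix_transpose hBA)

theorem measurable_of_measurableSet_graph {α β : Type*} [MeasurableSpace α] [StandardBorelSpace α]
    [MeasurableSpace β] [StandardBorelSpace β] {f : α → β}
    (hf : MeasurableSet {z : α × β | f z.1 = z.2}) : Measurable f := fun s hs => by
  have fst_injOn : Set.InjOn Prod.fst ({z : α × β | f z.1 = z.2} ∩ Prod.snd ⁻¹' s) :=
    fun z hz w hw hzw => Prod.ext hzw (hz.1.symm.trans ((congrArg f hzw).trans hw.1))
  convert (hf.inter (measurable_snd hs)).image_of_measurable_injOn measurable_fst fst_injOn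
  ext a
  constructor
  · exact fun ha => ⟨(a, f a), ⟨rfl, ha⟩, rfl⟩
  · rintro ⟨⟨a, b⟩, ⟨hab : f a = b, hb⟩, rfl⟩
    exact hab ▸ hb

theorem measurable_pinv :
    Measurable fun (A : Fin n → Fin p → ℝ) (a : Fin p) (b : Fin n) => pinv (Matrix.of A) a b := by
  refine measurable_of_measurableSet_graph ?_
  convert isClosed_isMoorePenrose (n := n) (p := p) |>.measurableSet using 1
  ext ⟨A, B⟩
  exact ⟨fun h : pinv (Matrix.of A) = B => h ▸ pinv_spec (Matrix.of A),
    fun h => (pinv_spec _).unique h⟩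

theorem pinv_eq_of_isUnit {A : Matrix (Fin n) (Fin p) ℝ} (h : IsUnit (Aᵀ * A).det) :
    pinv A = (Aᵀ * A)⁻¹ * Aᵀ := by
  refine (pinv_spec A).unique ⟨?_, ?_, ?_, ?_⟩
  · rw [Matrix.mul_assoc, Matrix.mul_assoc, nonsing_inv_mul _ h, Matrix.mul_one]
  · rw [Matrix.mul_assoc _ Aᵀ A, nonsing_inv_mul _ h, Matrix.one_mul]
  · simp [transpose_mul, transpose_nonsing_inv, Matrix.mul_assoc]
  · rw [Matrix.mul_assoc _ Aᵀ A, nonsing_inv_mul _ h, transpose_one]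

theorem pinv_mulVec_add_sub {A : Matrix (Fin n) (Fin p) ℝ} (h : IsUnit (Aᵀ * A).det)
    (β : Fin p → ℝ) (r : Fin n → ℝ) :
    pinv A *ᵥ (A *ᵥ β + r) - β = (Aᵀ * A)⁻¹ *ᵥ (Aᵀ *ᵥ r) := by
  rw [pinv_eq_of_isUnit h, mulVec_add, mulVec_mulVec β, Matrix.mul_assoc, nonsing_inv_mul _ h,
    one_mulVec, add_sub_cancel_left, mulVec_mulVec]

end MoorePenrose

section Regression

variable {n p : ℕ}

theorem transpose_dataMat_mul_dataMat (u : ℕ → Fin p → ℝ) :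
    (dataMat n u)ᵀ * dataMat n u = ∑ j ∈ Finset.range n, vecMulVec (u j) (u j) := by
  ext a b
  rw [Matrix.sum_apply, Finset.sum_range]
  rfl

theorem transpose_dataMat_mulVec (u : ℕ → Fin p → ℝ) (r : ℕ → ℝ) :
    ((dataMat n u)ᵀ *ᵥ fun j : Fin n => r j) = ∑ j ∈ Finset.range n, r j • u j := by
  ext a
  rw [Finset.sum_apply, Finset.sum_range, mulVec_transpose]
  rfl

/-- The empirical second moment matrix of the first `n` vectors of a sequence. -/
noncomputable def secondMoment (n : ℕ) (u : ℕ → Fin p → ℝ) : Matrix (Fin p) (Fin p) ℝ :=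
  (n : ℝ)⁻¹ • ∑ j ∈ Finset.range n, vecMulVec (u j) (u j)

theorem sqrt_smul_pinv_mulVec_sub {u : ℕ → Fin p → ℝ} (hu : IsUnit (secondMoment n u).det)
    (β : Fin p → ℝ) (r : ℕ → ℝ) :
    √n • (pinv (dataMat n u) *ᵥ (dataMat n u *ᵥ β + fun j : Fin n => r j) - β) =
      (secondMoment n u)⁻¹ *ᵥ ((√n)⁻¹ • ∑ j ∈ Finset.range n, r j • u j) := by
  have gram_isUnit : IsUnit ((dataMat n u)ᵀ * dataMat n u).det := by
    rw [transpose_dataMat_mul_dataMat]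
    rw [secondMoment, det_smul] at hu
    exact isUnit_of_mul_isUnit_right hu
  have inv_gram : ((dataMat n u)ᵀ * dataMat n u)⁻¹ = (n : ℝ)⁻¹ • (secondMoment n u)⁻¹ := by
    refine inv_eq_left_inv ?_
    rw [Matrix.smul_mul, ← Matrix.mul_smul, transpose_dataMat_mul_dataMat]
    exact nonsing_inv_mul _ hu
  rw [pinv_mulVec_add_sub gram_isUnit, transpose_dataMat_mulVec, inv_gram, smul_mulVec, smul_smul,
    mulVec_smul, ← div_eq_mul_inv, Real.sqrt_div_self]

end Regression

section AdditiveNoise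

variable {𝓧 : Type*} [MeasurableSpace 𝓧] {P : Measure 𝓧} {ν : Measure ℝ}

theorem memLp_two_mul_prod [SFinite P] [SFinite ν] {f : 𝓧 → ℝ} {g : ℝ → ℝ} (hf : MemLp f 2 P)
    (hg : MemLp g 2 ν) : MemLp (fun z => f z.1 * g z.2) 2 (P.prod ν) := by
  refine (memLp_two_iff_integrable_sq (hf.1.comp_fst.mul hg.1.comp_snd)).2 ?_
  simpa only [Pi.mul_apply, mul_pow] using hf.integrable_sq.mul_prod hg.integrable_sq

variable [IsProbabilityMeasure ν]

theorem memLp_two_add_mul_noise [SFinite P] (hν : MemLp (fun y => y) 2 ν) {f g : 𝓧 → ℝ}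
    (hf : MemLp f 2 P) (hg : MemLp g 2 P) : MemLp (fun z => f z.1 + g z.1 * z.2) 2 (P.prod ν) :=
  (hf.comp_fst ν).add (memLp_two_mul_prod hg hν)

theorem integral_add_mul_noise [SFinite P] (hν : Integrable (fun y => y) ν)
    (hν_mean : ∫ y, y ∂ν = 0) {f g : 𝓧 → ℝ} (hf : Integrable f P) (hg : Integrable g P) :
    ∫ z, f z.1 + g z.1 * z.2 ∂P.prod ν = ∫ x, f x ∂P := by
  rw [integral_add (hf.comp_fst ν) (hg.mul_prod hν), integral_fun_fst,
    integral_prod_mul g fun y => y, hν_mean]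
  simp

variable [IsProbabilityMeasure P]

theorem covariance_mul_noise (hν : MemLp (fun y => y) 2 ν) (hν_mean : ∫ y, y ∂ν = 0)
    {f g : 𝓧 → ℝ} (hf : MemLp f 2 P) (hg : MemLp g 2 P) :
    cov[fun z => f z.1, fun z => g z.1 * z.2; P.prod ν] = 0 := by
  rw [covariance_eq_sub (hf.comp_fst ν) (memLp_two_mul_prod hg hν),
    integral_prod_mul g fun y => y, hν_mean]
  simp only [Pi.mul_apply, ← mul_assoc]
  rw [integral_prod_mul (fun x => f x * g x) fun y => y, hν_mean]
  simp

theorem covariance_mul_noise_mul_noise (hν : MemLp (fun y => y) 2 ν) (hν_mean : ∫ y, y ∂ν = 0)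
    {g h : 𝓧 → ℝ} (hg : MemLp g 2 P) (hh : MemLp h 2 P) :
    cov[fun z => g z.1 * z.2, fun z => h z.1 * z.2; P.prod ν] =
      Var[fun y => y; ν] * ∫ x, g x * h x ∂P := by
  have regroup : ∀ z : 𝓧 × ℝ, g z.1 * z.2 * (h z.1 * z.2) = g z.1 * h z.1 * z.2 ^ 2 :=
    fun z => by ring
  have hvar : Var[fun y => y; ν] = ∫ y, y ^ 2 ∂ν :=
    variance_of_integral_eq_zero measurable_id.aemeasurable hν_mean
  rw [covariance_eq_sub (memLp_two_mul_prod hg hν) (memLp_two_mul_prod hh hν),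
    integral_prod_mul g fun y => y, hν_mean]
  simp only [Pi.mul_apply, regroup]
  rw [integral_prod_mul (fun x => g x * h x) fun y => y ^ 2, hvar]
  ring

theorem covMatrix_add_mul_noise {ι : Type*} (hν : MemLp (fun y => y) 2 ν) (hν_mean : ∫ y, y ∂ν = 0)
    {f g : ι → 𝓧 → ℝ} (hf : ∀ k, MemLp (f k) 2 P) (hg : ∀ k, MemLp (g k) 2 P) :
    covMatrix (fun k z => f k z.1 + g k z.1 * z.2) (P.prod ν) =
      covMatrix f P + Var[fun y => y; ν] • Matrix.of fun k l => ∫ x, g k x * g l x ∂P := by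
  ext k l
  have hf' := fun k => (hf k).comp_fst ν
  have hg' := fun k => memLp_two_mul_prod (hg k) hν
  have signal : cov[fun z => f k z.1, fun z => f l z.1; P.prod ν] = cov[f k, f l; P] :=
    measurePreserving_fst.hasLaw.covariance_fun_comp (hf k).1.aemeasurable (hf l).1.aemeasurable
  calc cov[fun z => f k z.1 + g k z.1 * z.2, fun z => f l z.1 + g l z.1 * z.2; P.prod ν]
      = cov[fun z => f k z.1, fun z => f l z.1; P.prod ν]
        + cov[fun z => f k z.1, fun z => g l z.1 * z.2; P.prod ν]
        + (cov[fun z => g k z.1 * z.2, fun z => f l z.1; P.prod ν]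
        + cov[fun z => g k z.1 * z.2, fun z => g l z.1 * z.2; P.prod ν]) := by
        rw [← covariance_add_right (hf' k) (hf' l) (hg' l),
          ← covariance_add_right (hg' k) (hf' l) (hg' l)]
        exact covariance_add_left (hf' k) (hg' k) ((hf' l).add (hg' l))
    _ = cov[f k, f l; P] + Var[fun y => y; ν] * ∫ x, g k x * g l x ∂P := by
        rw [signal, covariance_mul_noise hν hν_mean (hf k) (hg l),
          covariance_comm _ fun z : 𝓧 × ℝ => f l z.1,
          covariance_mul_noise hν hν_mean (hf l) (hg k),
          covariance_mul_noise_mul_noise hν hν_mean (hg k) (hg l)]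
        ring

end AdditiveNoise

section LocalRegression

variable {d p q n : ℕ} (e : Fin p ⊕ Fin q ≃ Fin d)

/-- The score `(θ₋ᵀ z₊ + ξ) x₊` of an agent at the sample `z = (x, ξ)`: the regressor of the local
least squares problem times the part of the label that the regressor does not explain. -/
noncomputable def score (S : Matrix (Fin d) (Fin d) ℝ) (θ : Fin d → ℝ) (z : (Fin d → ℝ) × ℝ) :
    Fin p → ℝ :=
  ((unseen e *ᵥ θ) ⬝ᵥ residual e S z.1 + z.2) • (seen e *ᵥ z.1)

theorem dataMat_mul_transpose_seen (x : ℕ → Fin d → ℝ) :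
    dataMat n x * (seen e)ᵀ = dataMat n fun j => seen e *ᵥ x j := by
  ext j a
  exact dotProduct_comm _ _

theorem labels_eq_dataMat_seen_mulVec_add {S : Matrix (Fin d) (Fin d) ℝ} (hS : S.IsSymm)
    (θ : Fin d → ℝ) (x : ℕ → Fin d → ℝ) (ξ : ℕ → ℝ) :
    labels n θ x ξ = dataMat n (fun j => seen e *ᵥ x j) *ᵥ (T e S *ᵥ θ) +
      fun j : Fin n => (unseen e *ᵥ θ) ⬝ᵥ residual e S (x j) + ξ j := by
  ext j
  have split := dotProduct_eq_seen_add_residual e hS (x j) θ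
  change x j ⬝ᵥ θ + ξ j = (seen e *ᵥ x j) ⬝ᵥ (T e S *ᵥ θ) + _
  rw [split, add_assoc]

theorem sqrt_smul_localOLS_sub {S : Matrix (Fin d) (Fin d) ℝ} (hS : S.IsSymm) (θ : Fin d → ℝ)
    (x : ℕ → Fin d → ℝ) (ξ : ℕ → ℝ)
    (hu : IsUnit (secondMoment n fun j => seen e *ᵥ x j).det) :
    √n • (localOLS e (dataMat n x) (labels n θ x ξ) - T e S *ᵥ θ) =
      (secondMoment n fun j => seen e *ᵥ x j)⁻¹ *ᵥ
        ((√n)⁻¹ • ∑ j ∈ Finset.range n, score e S θ (x j, ξ j)) := by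
  rw [localOLS, dataMat_mul_transpose_seen, labels_eq_dataMat_seen_mulVec_add e hS]
  exact sqrt_smul_pinv_mulVec_sub hu _ fun j => (unseen e *ᵥ θ) ⬝ᵥ residual e S (x j) + ξ j

end LocalRegression

section Population

variable {d p q : ℕ} (e : Fin p ⊕ Fin q ≃ Fin d) {S : Matrix (Fin d) (Fin d) ℝ}
  {P : Measure (Fin d → ℝ)} {θ : Fin d → ℝ}

theorem score_apply (S : Matrix (Fin d) (Fin d) ℝ) (θ : Fin d → ℝ) (z : (Fin d → ℝ) × ℝ)
    (k : Fin p) :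
    score e S θ z k = (seen e *ᵥ z.1) k * ((unseen e *ᵥ θ) ⬝ᵥ residual e S z.1) +
      (seen e *ᵥ z.1) k * z.2 := by
  rw [score, Pi.smul_apply, smul_eq_mul]
  ring

theorem measurable_score (S : Matrix (Fin d) (Fin d) ℝ) (θ : Fin d → ℝ) :
    Measurable (score e S θ) := by
  unfold score residual
  fun_prop

theorem memLp_seen (hP2 : ∀ k, MemLp (fun x : Fin d → ℝ => x k) 2 P) (k : Fin p) :
    MemLp (fun x : Fin d → ℝ => (seen e *ᵥ x) k) 2 P := by
  simpa only [seen_mulVec] using hP2 (e (Sum.inl k))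

section CenteredFeatures

variable [IsProbabilityMeasure P] (hP2 : ∀ k, MemLp (fun x : Fin d → ℝ => x k) 2 P)
  (hmean : ∀ k, ∫ x, x k ∂P = 0)
include hP2 hmean

theorem integral_mul_eq_covMat (k l : Fin d) : ∫ x, x k * x l ∂P = covMat P k l := by
  rw [covMat, of_apply, covariance_eq_sub (hP2 k) (hP2 l), hmean]
  simp

theorem integral_mul_dotProduct (k : Fin d) (w : Fin d → ℝ) :
    ∫ x, x k * (x ⬝ᵥ w) ∂P = (covMat P *ᵥ w) k := by
  have hint : ∀ l ∈ Finset.univ, Integrable (fun x : Fin d → ℝ => x k * x l * w l) P :=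
    fun l _ => ((hP2 k).integrable_mul (hP2 l)).mul_const (w l)
  simp only [dotProduct, Finset.mul_sum, mulVec, ← mul_assoc]
  rw [integral_finsetSum _ hint]
  exact Finset.sum_congr rfl fun l _ => by
    rw [integral_mul_const, integral_mul_eq_covMat hP2 hmean]

theorem integral_seen_mul_seen (k l : Fin p) :
    ∫ x, (seen e *ᵥ x) k * (seen e *ᵥ x) l ∂P = blockPlus e (covMat P) k l := by
  simp only [seen_mulVec]
  rw [integral_mul_eq_covMat hP2 hmean, blockPlus_eq_submatrix]
  rfl

theorem integral_seen_mul_residual (hcov : (covMat P).PosDef) (θ : Fin d → ℝ) (k : Fin p) :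
    ∫ x, (seen e *ᵥ x) k * ((unseen e *ᵥ θ) ⬝ᵥ residual e (covMat P) x) ∂P = 0 := by
  have annihilate : seen e * covMat P * (1 - (seen e)ᵀ * T e (covMat P)) = 0 := by
    rw [Matrix.mul_sub, Matrix.mul_one, ← Matrix.mul_assoc, ← blockPlus,
      blockPlus_mul_T e hcov, sub_self]
  simp only [unseen_dotProduct_residual e (isSymm_of_posDef hcov), seen_mulVec]
  rw [integral_mul_dotProduct hP2 hmean, ← seen_mulVec e (covMat P *ᵥ _), mulVec_mulVec,
    mulVec_mulVec, annihilate, zero_mulVec, Pi.zero_apply]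

end CenteredFeatures

variable [IsProbabilityMeasure P] (hP2 : ∀ k, MemLp (fun x : Fin d → ℝ => x k) 2 P)
  (hmean : ∀ k, ∫ x, x k ∂P = 0) (hcov : (covMat P).PosDef)
  (hP4 : ∀ k : Fin p, MemLp (fun x : Fin d → ℝ =>
    (seen e *ᵥ x) k * ((unseen e *ᵥ θ) ⬝ᵥ residual e (covMat P) x)) 2 P)

include hP2 hmean hcov hP4 in
theorem crossMoment_eq_covMatrix :
    crossMoment e P θ = covMatrix (fun k x =>
      (seen e *ᵥ x) k * ((unseen e *ᵥ θ) ⬝ᵥ residual e (covMat P) x)) P := by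
  ext k l
  rw [covMatrix, of_apply, covariance_eq_sub (hP4 k) (hP4 l),
    integral_seen_mul_residual e hP2 hmean hcov, zero_mul, sub_zero, crossMoment, of_apply]
  refine integral_congr_ae (ae_of_all _ fun x => ?_)
  simp only [Pi.mul_apply, dotProduct_comm (residual e (covMat P) x)]
  ring

variable {ν : Measure ℝ} [IsProbabilityMeasure ν] (hν : MemLp (fun y => y) 2 ν)
  (hν_mean : ∫ y, y ∂ν = 0) {σ : ℝ}

include hP2 hP4 hν in
theorem memLp_score (k : Fin p) : MemLp (fun z => score e (covMat P) θ z k) 2 (P.prod ν) := by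
  simp only [score_apply]
  exact memLp_two_add_mul_noise hν (hP4 k) (memLp_seen e hP2 k)

include hP2 hmean hcov hP4 hν hν_mean in
theorem integral_score (k : Fin p) : ∫ z, score e (covMat P) θ z k ∂P.prod ν = 0 := by
  simp only [score_apply]
  rw [integral_add_mul_noise (hν.integrable one_le_two) hν_mean ((hP4 k).integrable one_le_two)
    ((memLp_seen e hP2 k).integrable one_le_two), integral_seen_mul_residual e hP2 hmean hcov]

/-- The covariance matrix `E[x₊ θ₋ᵀ z₊ z₊ᵀ θ₋ x₊ᵀ] + σ² Σ₊` of the score. -/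
noncomputable def scoreCov (P : Measure (Fin d → ℝ)) (θ : Fin d → ℝ) (σ : ℝ) :
    Matrix (Fin p) (Fin p) ℝ :=
  crossMoment e P θ + σ ^ 2 • blockPlus e (covMat P)

include hP2 hmean hcov hP4 hν hν_mean in
theorem covMatrix_score (hσ : Var[fun y => y; ν] = σ ^ 2) :
    covMatrix (fun k z => score e (covMat P) θ z k) (P.prod ν) = scoreCov e P θ σ := by
  simp only [score_apply]
  rw [covMatrix_add_mul_noise hν hν_mean hP4 (memLp_seen e hP2), hσ, scoreCov,
    crossMoment_eq_covMatrix e hP2 hmean hcov hP4]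
  congr 2
  ext k l
  exact integral_seen_mul_seen e hP2 hmean k l

include hP2 hmean hcov hP4 in
theorem scoreCov_posDef (hσ : σ ≠ 0) : (scoreCov e P θ σ).PosDef := by
  rw [scoreCov, crossMoment_eq_covMatrix e hP2 hmean hcov hP4]
  exact PosDef.posSemidef_add (covMatrix_posSemidef hP4)
    ((blockPlus_posDef e hcov).smul (by positivity))

end Population

section LargeSamples

variable {Ω : Type*} [MeasurableSpace Ω] {μ : Measure Ω} {p : ℕ} {u : ℕ → Ω → Fin p → ℝ}

theorem secondMoment_apply (n : ℕ) (v : ℕ → Fin p → ℝ) (k l : Fin p) :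
    secondMoment n v k l = (n : ℝ)⁻¹ * ∑ j ∈ Finset.range n, v j k * v j l := by
  rw [secondMoment, Matrix.smul_apply, Matrix.sum_apply, smul_eq_mul]
  rfl

theorem ae_tendsto_secondMoment (hL2 : ∀ k, MemLp (fun ω => u 0 ω k) 2 μ)
    (hindep : Pairwise fun j l => IndepFun (u j) (u l) μ)
    (hident : ∀ j, IdentDistrib (u j) (u 0) μ μ) :
    ∀ᵐ ω ∂μ, Tendsto (fun n => secondMoment n fun j => u j ω) atTop
      (𝓝 (Matrix.of fun k l => ∫ ω, u 0 ω k * u 0 ω l ∂μ)) := by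
  have entrywise (k l : Fin p) : ∀ᵐ ω ∂μ, Tendsto (fun n => secondMoment n (fun j => u j ω) k l)
      atTop (𝓝 (∫ ω, u 0 ω k * u 0 ω l ∂μ)) := by
    have hφ : Measurable fun v : Fin p → ℝ => v k * v l := by fun_prop
    have lln := strong_law_ae (fun j ω => u j ω k * u j ω l) ((hL2 k).integrable_mul (hL2 l))
      (fun j l hjl => (hindep hjl).comp hφ hφ) fun j => (hident j).comp hφ
    simpa only [secondMoment_apply, smul_eq_mul] using lln
  filter_upwards [ae_all_iff.2 fun k => ae_all_iff.2 (entrywise k)] with ω hω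
  exact tendsto_pi_nhds.2 fun k => tendsto_pi_nhds.2 (hω k)

theorem aemeasurable_inv_secondMoment (hu : ∀ j, AEMeasurable (u j) μ) (n : ℕ) :
    AEMeasurable (fun ω k l => (secondMoment n fun j => u j ω)⁻¹ k l) μ := by
  refine measurable_matrix_inv.comp_aemeasurable
    (f := fun ω k l => secondMoment n (fun j => u j ω) k l) ?_
  simp only [secondMoment_apply]
  fun_prop

theorem aemeasurable_localOLS {d q : ℕ} (e : Fin p ⊕ Fin q ≃ Fin d) (θ : Fin d → ℝ)
    {x : ℕ → Ω → Fin d → ℝ} {ξ : ℕ → Ω → ℝ} (hx : ∀ j, AEMeasurable (x j) μ)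
    (hξ : ∀ j, AEMeasurable (ξ j) μ) (n : ℕ) :
    AEMeasurable (fun ω =>
      localOLS e (dataMat n fun j => x j ω) (labels n θ (x · ω) (ξ · ω))) μ := by
  have hX : AEMeasurable (fun ω (j : Fin n) => seen e *ᵥ x j ω) μ := by fun_prop
  have hpinv := measurable_pinv.comp_aemeasurable hX
  have hlabel (j : Fin n) : AEMeasurable (fun ω => labels n θ (x · ω) (ξ · ω) j) μ := by
    unfold labels dataMat mulVec dotProduct
    simp only [of_apply]
    fun_prop
  simp only [localOLS, dataMat_mul_transpose_seen]
  refine aemeasurable_pi_iff.2 fun a => ?_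
  have hterm (j : Fin n) :=
    (aemeasurable_pi_iff.1 (aemeasurable_pi_iff.1 hpinv a) j).mul (hlabel j)
  exact Finset.aemeasurable_fun_sum Finset.univ fun j _ => hterm j

theorem ae_tendsto_secondMoment_seen {d q : ℕ} (e : Fin p ⊕ Fin q ≃ Fin d)
    {P : Measure (Fin d → ℝ)} [IsProbabilityMeasure P]
    (hP2 : ∀ k, MemLp (fun x : Fin d → ℝ => x k) 2 P) (hmean : ∀ k, ∫ x, x k ∂P = 0)
    {x : ℕ → Ω → Fin d → ℝ} (hx : ∀ j, HasLaw (x j) P μ)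
    (hindep : Pairwise fun j l => IndepFun (x j) (x l) μ) :
    ∀ᵐ ω ∂μ, Tendsto (fun n => secondMoment n fun j => seen e *ᵥ x j ω) atTop
      (𝓝 (blockPlus e (covMat P))) := by
  have hφ : Measurable fun v : Fin d → ℝ => seen e *ᵥ v := by fun_prop
  have hL2 (k : Fin p) : MemLp (fun ω => (seen e *ᵥ x 0 ω) k) 2 μ := by
    have h := memLp_seen e hP2 k
    rw [← (hx 0).map_eq] at h
    exact h.comp_of_map (hx 0).aemeasurable
  have lln := ae_tendsto_secondMoment hL2 (fun j l hjl => (hindep hjl).comp hφ hφ)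
    fun j => ((hx j).identDistrib (hx 0)).comp hφ
  have limit_eq : (Matrix.of fun k l => ∫ ω, (seen e *ᵥ x 0 ω) k * (seen e *ᵥ x 0 ω) l ∂μ) =
      blockPlus e (covMat P) := by
    ext k l
    rw [← integral_seen_mul_seen e hP2 hmean]
    exact (hx 0).integral_comp (f := fun v => (seen e *ᵥ v) k * (seen e *ᵥ v) l)
      (by fun_prop)
  rw [← limit_eq]
  exact lln

end LargeSamples

section StackedScores

variable {m d : ℕ} {p q : Fin m → ℕ} (e : ∀ i, Fin (p i) ⊕ Fin (q i) ≃ Fin d)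

/-- The scores of all agents at one sample each, stacked into one vector. -/
noncomputable def stackedScore (S : Matrix (Fin d) (Fin d) ℝ) (θ : Fin d → ℝ)
    (z : Fin m → (Fin d → ℝ) × ℝ) : EuclideanSpace ℝ (Σ i, Fin (p i)) :=
  WithLp.toLp 2 fun s => score (e s.1) S θ (z s.1) s.2

theorem measurable_stackedScore (S : Matrix (Fin d) (Fin d) ℝ) (θ : Fin d → ℝ) :
    Measurable (stackedScore e S θ) := by
  refine (PiLp.continuous_toLp 2 _).measurable.comp (measurable_pi_iff.2 fun s => ?_)
  exact measurable_pi_iff.1 ((measurable_score (e s.1) S θ).comp (measurable_pi_apply s.1)) s.2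

variable {P : Measure (Fin d → ℝ)} [IsProbabilityMeasure P] {θ : Fin d → ℝ}
  (hP2 : ∀ k, MemLp (fun x : Fin d → ℝ => x k) 2 P)
  (hmean : ∀ k, ∫ x, x k ∂P = 0) (hcov : (covMat P).PosDef)
  (hP4 : ∀ (i : Fin m) (k : Fin (p i)), MemLp (fun x : Fin d → ℝ =>
    (seen (e i) *ᵥ x) k * ((unseen (e i) *ᵥ θ) ⬝ᵥ residual (e i) (covMat P) x)) 2 P)
  {ν : Fin m → Measure ℝ} [∀ i, IsProbabilityMeasure (ν i)]
  (hν : ∀ i, MemLp (fun y => y) 2 (ν i)) (hν_mean : ∀ i, ∫ y, y ∂ν i = 0)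
  {Ω : Type*} [MeasurableSpace Ω] {μ : Measure Ω}

section SingleSample

variable {z : Fin m → Ω → (Fin d → ℝ) × ℝ} (hz : ∀ i, HasLaw (z i) (P.prod (ν i)) μ)

include hP2 hP4 hν hz in
theorem memLp_stackedScore (s : Σ i, Fin (p i)) :
    MemLp (fun ω => stackedScore e (covMat P) θ (z · ω) s) 2 μ := by
  have h := memLp_score (e s.1) hP2 (hP4 s.1) (hν s.1) s.2
  rw [← (hz s.1).map_eq] at h
  exact h.comp_of_map (hz s.1).aemeasurable

include hP2 hmean hcov hP4 hν hν_mean hz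

theorem integral_stackedScore (s : Σ i, Fin (p i)) :
    ∫ ω, stackedScore e (covMat P) θ (z · ω) s ∂μ = 0 := by
  rw [← integral_score (e s.1) hP2 hmean hcov (hP4 s.1) (hν s.1) (hν_mean s.1) s.2]
  exact (hz s.1).integral_comp
    (measurable_pi_iff.1 (measurable_score (e s.1) _ θ) s.2).aestronglyMeasurable

theorem covMatrix_stackedScore [IsProbabilityMeasure μ] {σ : Fin m → ℝ}
    (hσ : ∀ i, Var[fun y => y; ν i] = σ i ^ 2) (hindep : iIndepFun z μ) :
    covMatrix (fun s ω => stackedScore e (covMat P) θ (z · ω) s) μ =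
      blockDiagonal' fun i => scoreCov (e i) P θ (σ i) := by
  have hscore (i : Fin m) (a : Fin (p i)) : Measurable fun w => score (e i) (covMat P) θ w a :=
    measurable_pi_iff.1 (measurable_score (e i) _ θ) a
  rw [covMatrix_sigma (memLp_stackedScore e hP2 hP4 hν hz) fun i j hij a b =>
    (hindep.indepFun hij).comp (hscore i a) (hscore j b)]
  congr 1
  funext i
  rw [← covMatrix_score (e i) hP2 hmean hcov (hP4 i) (hν i) (hν_mean i) (hσ i)]
  ext a b
  exact (hz i).covariance_fun_comp (hscore i a).aemeasurable (hscore i b).aemeasurable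

end SingleSample

include hP2 hmean hcov hP4 hν hν_mean in
theorem tendstoInDistribution_stackedScore [IsProbabilityMeasure μ] {σ : Fin m → ℝ}
    (hσ : ∀ i, Var[fun y => y; ν i] = σ i ^ 2) {z : Fin m → ℕ → Ω → (Fin d → ℝ) × ℝ}
    (hz : ∀ i j, HasLaw (z i j) (P.prod (ν i)) μ)
    (hindep : iIndepFun (fun (a : Fin m × ℕ) ω => z a.1 a.2 ω) μ) :
    TendstoInDistribution (fun (n : ℕ) ω =>
        (√n : ℝ)⁻¹ • ∑ j ∈ Finset.range n, stackedScore e (covMat P) θ (z · j ω)) atTop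
      (id : EuclideanSpace ℝ (Σ i, Fin (p i)) → EuclideanSpace ℝ (Σ i, Fin (p i))) (fun _ => μ)
      (multivariateGaussian 0 (blockDiagonal' fun i => scoreCov (e i) P θ (σ i))) := by
  have indep_samples : iIndepFun (fun j ω i => z i j ω) μ :=
    iIndepFun_curry (X := fun j i => z i j) (fun j i => (hz i j).aemeasurable)
      (hindep.precomp (g := Prod.swap) Prod.swap_injective)
  have indep_agents (j : ℕ) : iIndepFun (fun i => z i j) μ :=
    hindep.precomp (g := fun i => (i, j)) (Prod.mk_left_injective j)
  have identDistrib_samples (j : ℕ) :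
      IdentDistrib (fun ω i => z i j ω) (fun ω i => z i 0 ω) μ μ :=
    identDistrib_pi (indep_agents j) (indep_agents 0) fun i => (hz i j).identDistrib (hz i 0)
  have hmeas := measurable_stackedScore e (covMat P) θ
  rw [← covMatrix_stackedScore e hP2 hmean hcov hP4 hν hν_mean (hz · 0) hσ (indep_agents 0)]
  exact tendstoInDistribution_inv_sqrt_smul_sum (indep_samples.comp (fun _ => _) fun _ => hmeas)
    (fun j => (identDistrib_samples j).comp hmeas)
    (memLp_stackedScore e hP2 hP4 hν (hz · 0))
    (integral_stackedScore e hP2 hmean hcov hP4 hν hν_mean (hz · 0))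

end StackedScores

section LocalCovariance

variable {d p q : ℕ} (e : Fin p ⊕ Fin q ≃ Fin d)

/-- The covariance matrix `Σ₊⁻¹ (E[x₊ θ₋ᵀ z₊ z₊ᵀ θ₋ x₊ᵀ] + σ² Σ₊) Σ₊⁻¹` of the limit distribution
of `√n (θ̂ - T θ)` for the local estimate `θ̂`. -/
noncomputable def localCov (P : Measure (Fin d → ℝ)) (θ : Fin d → ℝ) (σ : ℝ) :
    Matrix (Fin p) (Fin p) ℝ :=
  (blockPlus e (covMat P))⁻¹ * scoreCov e P θ σ * (blockPlus e (covMat P))⁻¹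

variable {P : Measure (Fin d → ℝ)} {θ : Fin d → ℝ} {σ : ℝ} (hcov : (covMat P).PosDef)
include hcov

theorem inv_localCov : (localCov e P θ σ)⁻¹ = optWeight e P θ σ := by
  have hu := isUnit_det_of_posDef (blockPlus_posDef e hcov)
  rw [localCov, optWeight, Matrix.mul_inv_rev, Matrix.mul_inv_rev, nonsing_inv_nonsing_inv _ hu,
    scoreCov, Matrix.mul_assoc]

theorem localCov_posDef (hQ : (scoreCov e P θ σ).PosDef) : (localCov e P θ σ).PosDef := by
  have hS := (blockPlus_posDef e hcov).inv
  have h := posDef_transpose_mul_mul hQ (mulVec_injective_iff_isUnit.2 hS.isUnit)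
  rwa [(isSymm_of_posDef hS).eq] at h

theorem optWeight_posDef (hQ : (scoreCov e P θ σ).PosDef) : (optWeight e P θ σ).PosDef :=
  inv_localCov e hcov ▸ (localCov_posDef e hcov hQ).inv

end LocalCovariance

section AggregateCovariance

variable {m d : ℕ} {p q : Fin m → ℕ} (e : ∀ i, Fin (p i) ⊕ Fin (q i) ≃ Fin d)

/-- The covariance matrix of the limit distribution of the aggregated estimate, which is linear in
the local estimates. -/
noncomputable def aggCov (P : Measure (Fin d → ℝ)) (θ : Fin d → ℝ) (σ : Fin m → ℝ)
    (W : ∀ i, Matrix (Fin (p i)) (Fin (p i)) ℝ) : Matrix (Fin d) (Fin d) ℝ :=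
  wlsGain (jointT e (covMat P)) (blockDiagonal' W) *
    blockDiagonal' (fun i => localCov (e i) P θ (σ i)) *
    (wlsGain (jointT e (covMat P)) (blockDiagonal' W))ᵀ

variable {P : Measure (Fin d → ℝ)} {θ : Fin d → ℝ} {σ : Fin m → ℝ}
  {W : ∀ i, Matrix (Fin (p i)) (Fin (p i)) ℝ}

theorem inv_blockDiagonal'_localCov (hcov : (covMat P).PosDef)
    (hV : ∀ i, (localCov (e i) P θ (σ i)).PosDef) :
    (blockDiagonal' fun i => localCov (e i) P θ (σ i))⁻¹ =
      blockDiagonal' fun i => optWeight (e i) P θ (σ i) := by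
  rw [inv_blockDiagonal' fun i => isUnit_det_of_posDef (hV i)]
  simp only [inv_localCov _ hcov]

theorem blockDiagonal'_localCov (hcov : (covMat P).PosDef) :
    (blockDiagonal' fun i => localCov (e i) P θ (σ i)) =
      blockDiagonal' (fun i => (blockPlus (e i) (covMat P))⁻¹) *
        blockDiagonal' (fun i => scoreCov (e i) P θ (σ i)) *
        (blockDiagonal' fun i => (blockPlus (e i) (covMat P))⁻¹)ᵀ := by
  have hsymm (i : Fin m) := (isSymm_of_posDef (blockPlus_posDef (e i) hcov).inv).eq
  simp only [blockDiagonal'_transpose, hsymm, ← blockDiagonal'_mul]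
  rfl

theorem aggCov_posSemidef (hV : ∀ i, (localCov (e i) P θ (σ i)).PosDef) :
    (aggCov e P θ σ W).PosSemidef :=
  posSemidef_mul_mul_transpose (posDef_blockDiagonal' hV).posSemidef _

variable (hcover : ∀ k : Fin d, ∃ (i : Fin m) (a : Fin (p i)), e i (Sum.inl a) = k)
  (hcov : (covMat P).PosDef) (hQ : ∀ i, (scoreCov (e i) P θ (σ i)).PosDef)
include hcover hcov hQ

theorem aggCov_optWeight_eq_inv_normalMatrix :
    aggCov e P θ σ (fun i => optWeight (e i) P θ (σ i)) =
      ((jointT e (covMat P))ᵀ * blockDiagonal' (fun i => optWeight (e i) P θ (σ i)) *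
        jointT e (covMat P))⁻¹ := by
  have hV := fun i => localCov_posDef (e i) hcov (hQ i)
  have hH := posDef_jointT_normalMatrix e hcover hcov fun i => optWeight_posDef (e i) hcov (hQ i)
  rw [aggCov]
  simp only [← inv_blockDiagonal'_localCov e hcov hV] at hH ⊢
  exact mul_mul_transpose_wlsGain_inv (posDef_blockDiagonal' hV) (wlsGain_mul hH)

theorem aggCov_optWeight :
    aggCov e P θ σ (fun i => optWeight (e i) P θ (σ i)) =
      (∑ i, (T (e i) (covMat P))ᵀ * optWeight (e i) P θ (σ i) * T (e i) (covMat P))⁻¹ := by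
  rw [aggCov_optWeight_eq_inv_normalMatrix e hcover hcov hQ, jointT,
    transpose_stackRows_mul_blockDiagonal'_mul]

theorem aggCov_sub_aggCov_optWeight_posSemidef (hW : ∀ i, (W i).PosDef) :
    (aggCov e P θ σ W - aggCov e P θ σ fun i => optWeight (e i) P θ (σ i)).PosSemidef := by
  have hV := fun i => localCov_posDef (e i) hcov (hQ i)
  have hH := posDef_jointT_normalMatrix e hcover hcov fun i => optWeight_posDef (e i) hcov (hQ i)
  rw [aggCov_optWeight_eq_inv_normalMatrix e hcover hcov hQ]
  simp only [← inv_blockDiagonal'_localCov e hcov hV] at hH ⊢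
  exact posSemidef_mul_mul_transpose_sub_inv (posDef_blockDiagonal' hV) hH
    (wlsGain_mul (posDef_jointT_normalMatrix e hcover hcov hW))

end AggregateCovariance

section AsymptoticNormality

variable {m d : ℕ} {p q : Fin m → ℕ} (e : ∀ i, Fin (p i) ⊕ Fin (q i) ≃ Fin d)
  {θ : Fin d → ℝ}

theorem sqrt_smul_stacked_localEstimates_sub {S : Matrix (Fin d) (Fin d) ℝ} (hS : S.IsSymm)
    (n : ℕ) (x : Fin m → ℕ → Fin d → ℝ) (ξ : Fin m → ℕ → ℝ)
    (hu : ∀ i, IsUnit (secondMoment n fun j => seen (e i) *ᵥ x i j).det) :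
    √n • ((fun s : Σ i, Fin (p i) => localEstimates e θ n x ξ s.1 s.2) - jointT e S *ᵥ θ) =
      blockDiagonal' (fun i => (secondMoment n fun j => seen (e i) *ᵥ x i j)⁻¹) *ᵥ
        ((√n)⁻¹ • ∑ j ∈ Finset.range n, stackedScore e S θ fun i => (x i j, ξ i j)).ofLp := by
  rw [blockDiagonal'_mulVec]
  funext ⟨i, a⟩
  refine (congrFun (sqrt_smul_localOLS_sub (e i) hS θ (x i) (ξ i) (hu i)) a).trans ?_
  congr 2
  ext b
  simp [stackedScore]

section Data

variable {Ω : Type*} [MeasurableSpace Ω] {μ : Measure Ω} {x : Fin m → ℕ → Ω → Fin d → ℝ}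

theorem aemeasurable_blockDiagonal'_inv_secondMoment_seen (hx : ∀ i j, AEMeasurable (x i j) μ)
    (n : ℕ) :
    AEMeasurable (fun ω (s t : Σ i, Fin (p i)) => blockDiagonal' (fun i =>
      (secondMoment n fun j => seen (e i) *ᵥ x i j ω)⁻¹) s t) μ := by
  refine aemeasurable_pi_iff.2 fun ⟨i, a⟩ => aemeasurable_pi_iff.2 fun ⟨l, b⟩ => ?_
  by_cases hil : i = l
  · subst hil
    have hseen (j : ℕ) : AEMeasurable (fun ω => seen (e i) *ᵥ x i j ω) μ := by fun_prop
    simp only [blockDiagonal'_apply_eq]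
    exact aemeasurable_pi_iff.1 (aemeasurable_pi_iff.1 (aemeasurable_inv_secondMoment hseen n) a) b
  · simp only [blockDiagonal'_apply_ne _ _ _ hil]
    exact aemeasurable_const

theorem aemeasurable_sqrt_smul_stacked_localEstimates_sub (S : Matrix (Fin d) (Fin d) ℝ)
    {ξ : Fin m → ℕ → Ω → ℝ} (hx : ∀ i j, AEMeasurable (x i j) μ)
    (hξ : ∀ i j, AEMeasurable (ξ i j) μ) (n : ℕ) :
    AEMeasurable (fun ω => WithLp.toLp 2 (√n • ((fun s : Σ i, Fin (p i) =>
      localEstimates e θ n (fun i j => x i j ω) (fun i j => ξ i j ω) s.1 s.2) -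
        jointT e S *ᵥ θ))) μ := by
  have local_meas (s : Σ i, Fin (p i)) := aemeasurable_pi_iff.1
    (aemeasurable_localOLS (e s.1) θ (hx s.1) (hξ s.1) n) s.2
  refine (PiLp.continuous_toLp 2 _).measurable.comp_aemeasurable
    (AEMeasurable.const_smul ?_ (√n : ℝ))
  exact (aemeasurable_pi_iff.2 local_meas).sub_const _

theorem ae_tendsto_secondMoment_seen_agents {P : Measure (Fin d → ℝ)} [IsProbabilityMeasure P]
    (hP2 : ∀ k, MemLp (fun x : Fin d → ℝ => x k) 2 P) (hmean : ∀ k, ∫ x, x k ∂P = 0)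
    (hx : ∀ i j, HasLaw (x i j) P μ)
    (hindep : iIndepFun (fun (a : Fin m × ℕ) => x a.1 a.2) μ) :
    ∀ᵐ ω ∂μ, ∀ i, Tendsto (fun n => secondMoment n fun j => seen (e i) *ᵥ x i j ω) atTop
      (𝓝 (blockPlus (e i) (covMat P))) :=
  ae_all_iff.2 fun i => ae_tendsto_secondMoment_seen (e i) hP2 hmean (hx i) fun j l hjl =>
    hindep.indepFun (i := (i, j)) (j := (i, l)) (by simpa using hjl)

end Data

variable {P : Measure (Fin d → ℝ)} [IsProbabilityMeasure P]
  (hP2 : ∀ k, MemLp (fun x : Fin d → ℝ => x k) 2 P)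
  (hmean : ∀ k, ∫ x, x k ∂P = 0) (hcov : (covMat P).PosDef)
  (hP4 : ∀ (i : Fin m) (k : Fin (p i)), MemLp (fun x : Fin d → ℝ =>
    (seen (e i) *ᵥ x) k * ((unseen (e i) *ᵥ θ) ⬝ᵥ residual (e i) (covMat P) x)) 2 P)
  {ν : Fin m → Measure ℝ} [∀ i, IsProbabilityMeasure (ν i)]
  (hν : ∀ i, MemLp (fun y => y) 2 (ν i)) (hν_mean : ∀ i, ∫ y, y ∂ν i = 0)
  {σ : Fin m → ℝ} (hσ : ∀ i, σ i ≠ 0) (hν_var : ∀ i, Var[fun y => y; ν i] = σ i ^ 2)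
  {Ω : Type*} [MeasurableSpace Ω] {μ : Measure Ω} [IsProbabilityMeasure μ]
  {x : Fin m → ℕ → Ω → Fin d → ℝ} {ξ : Fin m → ℕ → Ω → ℝ}
  (hx : ∀ i j, HasLaw (x i j) P μ) (hξ : ∀ i j, HasLaw (ξ i j) (ν i) μ)
  (hxξ : ∀ i j, IndepFun (x i j) (ξ i j) μ)
  (hindep : iIndepFun (fun (a : Fin m × ℕ) ω => (x a.1 a.2 ω, ξ a.1 a.2 ω)) μ)

include hP2 hmean hcov hP4 hν hν_mean hσ hν_var hx hξ hxξ hindep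

theorem tendstoInDistribution_stacked_localEstimates :
    TendstoInDistribution (fun (n : ℕ) ω => WithLp.toLp 2 (√n •
        ((fun s : Σ i, Fin (p i) => localEstimates e θ n (fun i j => x i j ω)
          (fun i j => ξ i j ω) s.1 s.2) - jointT e (covMat P) *ᵥ θ)))
      atTop (id : EuclideanSpace ℝ (Σ i, Fin (p i)) → EuclideanSpace ℝ (Σ i, Fin (p i)))
      (fun _ => μ)
      (multivariateGaussian 0 (blockDiagonal' fun i => localCov (e i) P θ (σ i))) := by
  have hS (i : Fin m) := isUnit_det_of_posDef (blockPlus_posDef (e i) hcov)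
  have hQ (i : Fin m) := scoreCov_posDef (e i) hP2 hmean hcov (hP4 i) (hσ i)
  have second_moments := ae_tendsto_secondMoment_seen_agents e hP2 hmean hx
    (hindep.comp (fun _ => Prod.fst) fun _ => measurable_fst)
  have scores := tendstoInDistribution_stackedScore e hP2 hmean hcov hP4 hν hν_mean hν_var
    (fun i j => (hxξ i j).hasLaw_prod (hx i j) (hξ i j)) hindep
  rw [blockDiagonal'_localCov e hcov]
  refine tendstoInDistribution_mulVec (posDef_blockDiagonal' hQ).posSemidef scores
    (aemeasurable_blockDiagonal'_inv_secondMoment_seen e fun i j => (hx i j).aemeasurable) ?_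
    (aemeasurable_sqrt_smul_stacked_localEstimates_sub e _ (fun i j => (hx i j).aemeasurable)
      fun i j => (hξ i j).aemeasurable) ?_
  · filter_upwards [second_moments] with ω hω
    exact tendsto_blockDiagonal' fun i =>
      (continuousAt_matrix_inv_of_isUnit (hS i)).tendsto.comp (hω i)
  · filter_upwards [second_moments] with ω hω
    filter_upwards [eventually_all.2 fun i => eventually_isUnit_det (hS i) (hω i)] with n hn
    exact congrArg (WithLp.toLp 2)
      (sqrt_smul_stacked_localEstimates_sub e (isSymm_of_posDef hcov) n _ _ hn)

theorem tendstoInDistribution_aggregate {W : ∀ i, Matrix (Fin (p i)) (Fin (p i)) ℝ}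
    (hcover : ∀ k : Fin d, ∃ (i : Fin m) (a : Fin (p i)), e i (Sum.inl a) = k)
    (hW : ∀ i, (W i).PosDef) :
    TendstoInDistribution (fun (n : ℕ) ω => WithLp.toLp 2 (√n • (aggregate e (covMat P) W
        (localEstimates e θ n (fun i j => x i j ω) (fun i j => ξ i j ω)) - θ)))
      atTop (id : EuclideanSpace ℝ (Fin d) → EuclideanSpace ℝ (Fin d)) (fun _ => μ)
      (multivariateGaussian 0 (aggCov e P θ σ W)) := by
  have hH := posDef_jointT_normalMatrix e hcover hcov hW
  have hV (i : Fin m) := localCov_posDef (e i) hcov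
    (scoreCov_posDef (e i) hP2 hmean hcov (hP4 i) (hσ i))
  set G := wlsGain (jointT e (covMat P)) (blockDiagonal' W)
  have linear (c : ℝ) (θloc : ∀ i, Fin (p i) → ℝ) :
      c • (aggregate e (covMat P) W θloc - θ) =
        G *ᵥ (c • ((fun s : Σ i, Fin (p i) => θloc s.1 s.2) - jointT e (covMat P) *ᵥ θ)) := by
    rw [aggregate_eq e hW hH, mulVec_smul, mulVec_sub, mulVec_mulVec, wlsGain_mul hH, one_mulVec]
  have limit_law := hasLaw_mulVec_multivariateGaussian (posDef_blockDiagonal' hV).posSemidef 0 G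
  simp only [linear]
  rw [WithLp.ofLp_zero, mulVec_zero, WithLp.toLp_zero] at limit_law
  have local_normality := tendstoInDistribution_stacked_localEstimates e hP2 hmean hcov hP4 hν
    hν_mean hσ hν_var hx hξ hxξ hindep
  have G_continuous : Continuous fun v : EuclideanSpace ℝ (Σ i, Fin (p i)) =>
      (WithLp.toLp 2 (G *ᵥ v.ofLp) : EuclideanSpace ℝ (Fin d)) := by fun_prop
  have mapped_normality := local_normality.continuous_comp G_continuous
  exact tendstoInDistribution_id_of_hasLaw mapped_normality limit_law

end AsymptoticNormality

end Collab

theorem mainTheorem3_general {m d : ℕ} {p q : Fin m → ℕ}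
    (e : ∀ i, Fin (p i) ⊕ Fin (q i) ≃ Fin d)
    (hcover : ∀ k : Fin d, ∃ (i : Fin m) (a : Fin (p i)), e i (Sum.inl a) = k)
    (P : Measure (Fin d → ℝ)) [IsProbabilityMeasure P]
    (hP2 : ∀ k, MemLp (fun x : Fin d → ℝ => x k) 2 P)
    (hmean : ∀ k, ∫ x, x k ∂P = 0)
    (hcov : (Collab.covMat P).PosDef)
    (ν : Fin m → Measure ℝ) [∀ i, IsProbabilityMeasure (ν i)]
    (hν : ∀ i, MemLp (fun y => y) 2 (ν i)) (hν_mean : ∀ i, ∫ y, y ∂ν i = 0)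
    (θ : Fin d → ℝ) (σ : Fin m → ℝ) (hσ : ∀ i, σ i ≠ 0)
    (hν_var : ∀ i, Var[fun y => y; ν i] = σ i ^ 2)
    (hP4 : ∀ (i : Fin m) (k : Fin (p i)), MemLp (fun x : Fin d → ℝ =>
      (Collab.seen (e i) *ᵥ x) k *
        ((Collab.unseen (e i) *ᵥ θ) ⬝ᵥ Collab.residual (e i) (Collab.covMat P) x)) 2 P)
    {Ω : Type*} [MeasurableSpace Ω] (μ : Measure Ω) [IsProbabilityMeasure μ]
    (x : Fin m → ℕ → Ω → Fin d → ℝ) (ξ : Fin m → ℕ → Ω → ℝ)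
    (hx : ∀ i j, HasLaw (x i j) P μ)
    (hξ : ∀ i j, HasLaw (ξ i j) (ν i) μ)
    (hxξ : ∀ i j, IndepFun (x i j) (ξ i j) μ)
    (hindep : iIndepFun (fun (a : Fin m × ℕ) ω => (x a.1 a.2 ω, ξ a.1 a.2 ω)) μ) :
    ∃ C : (∀ i, Matrix (Fin (p i)) (Fin (p i)) ℝ) → Matrix (Fin d) (Fin d) ℝ,
      (∀ W : ∀ i, Matrix (Fin (p i)) (Fin (p i)) ℝ, (∀ i, (W i).PosDef) →
        (∀ n ω t, IsMinOn (Collab.aggObjective e (Collab.covMat P) W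
            (Collab.localEstimates e θ n (fun i j => x i j ω) (fun i j => ξ i j ω))) Set.univ t ↔
          t = Collab.aggregate e (Collab.covMat P) W
            (Collab.localEstimates e θ n (fun i j => x i j ω) (fun i j => ξ i j ω))) ∧
        (C W).PosSemidef ∧
        TendstoInDistribution
          (fun (n : ℕ) ω => WithLp.toLp 2 (Real.sqrt n •
            (Collab.aggregate e (Collab.covMat P) W
              (Collab.localEstimates e θ n (fun i j => x i j ω) (fun i j => ξ i j ω)) - θ)))
          atTop (id : EuclideanSpace ℝ (Fin d) → EuclideanSpace ℝ (Fin d)) (fun _ => μ)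
          (multivariateGaussian 0 (C W))) ∧
      (∀ i, (Collab.optWeight (e i) P θ (σ i)).PosDef) ∧
      C (fun i => Collab.optWeight (e i) P θ (σ i)) =
        (∑ i, (Collab.T (e i) (Collab.covMat P))ᵀ * Collab.optWeight (e i) P θ (σ i) *
          Collab.T (e i) (Collab.covMat P))⁻¹ ∧
      ∀ W : ∀ i, Matrix (Fin (p i)) (Fin (p i)) ℝ, (∀ i, (W i).PosDef) →
        (C W - C (fun i => Collab.optWeight (e i) P θ (σ i))).PosSemidef := by
  have hQ (i : Fin m) := Collab.scoreCov_posDef (e i) hP2 hmean hcov (hP4 i) (hσ i)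
  refine ⟨Collab.aggCov e P θ σ, fun W hW => ⟨fun n ω => ?minimizer, ?posSemidef, ?normality⟩,
    fun i => Collab.optWeight_posDef (e i) hcov (hQ i), ?optimal_value, fun W hW => ?optimal⟩
  case minimizer => exact Collab.isMinOn_aggObjective_iff e hcover hcov hW _
  case posSemidef =>
    exact Collab.aggCov_posSemidef e fun i => Collab.localCov_posDef (e i) hcov (hQ i)
  case normality =>
    exact Collab.tendstoInDistribution_aggregate e hP2 hmean hcov hP4 hν hν_mean hσ hν_var hx hξ
      hxξ hindep hcover hW
  case optimal_value => exact Collab.aggCov_optWeight e hcover hcov hQ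
  case optimal => exact Collab.aggCov_sub_aggCov_optWeight_posSemidef e hcover hcov hQ hW

theorem mainTheorem3 {m d : ℕ} {p q : Fin m → ℕ}
    -- the views of the agents; every feature is seen by at least one agent
    (e : ∀ i, Fin (p i) ⊕ Fin (q i) ≃ Fin d)
    (hcover : ∀ k : Fin d, ∃ (i : Fin m) (a : Fin (p i)), e i (Sum.inl a) = k)
    -- the feature distribution, the parameter and the noise level
    (P : Measure (Fin d → ℝ)) [IsProbabilityMeasure P]
    (hP2 : ∀ k, MemLp (fun x : Fin d → ℝ => x k) 2 P)
    (hmean : ∀ k, ∫ x, x k ∂P = 0)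
    (hcov : (Collab.covMat P).PosDef)
    (θ : Fin d → ℝ) (σ : ℝ≥0) (hσ : 0 < σ)
    (hP4 : ∀ (i : Fin m) (k : Fin (p i)), MemLp (fun x : Fin d → ℝ =>
      (Collab.seen (e i) *ᵥ x) k *
        ((Collab.unseen (e i) *ᵥ θ) ⬝ᵥ Collab.residual (e i) (Collab.covMat P) x)) 2 P)
    -- the samples: `x i j` and `ξ i j` are the `j`-th feature vector and noise of agent `i`
    {Ω : Type*} [MeasurableSpace Ω] (μ : Measure Ω) [IsProbabilityMeasure μ]
    (x : Fin m → ℕ → Ω → Fin d → ℝ) (ξ : Fin m → ℕ → Ω → ℝ)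
    (hx : ∀ i j, HasLaw (x i j) P μ)
    (hξ : ∀ i j, HasLaw (ξ i j) (gaussianReal 0 (σ ^ 2)) μ)
    (hxξ : ∀ i j, IndepFun (x i j) (ξ i j) μ)
    (hindep : iIndepFun (fun (a : Fin m × ℕ) ω => (x a.1 a.2 ω, ξ a.1 a.2 ω)) μ) :
    ∃ C : (∀ i, Matrix (Fin (p i)) (Fin (p i)) ℝ) → Matrix (Fin d) (Fin d) ℝ,
      (∀ W : ∀ i, Matrix (Fin (p i)) (Fin (p i)) ℝ, (∀ i, (W i).PosDef) →
        -- the aggregated estimator is the unique minimizer of the weighted objective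
        (∀ n ω t, IsMinOn (Collab.aggObjective e (Collab.covMat P) W
            (Collab.localEstimates e θ n (fun i j => x i j ω) (fun i j => ξ i j ω))) Set.univ t ↔
          t = Collab.aggregate e (Collab.covMat P) W
            (Collab.localEstimates e θ n (fun i j => x i j ω) (fun i j => ξ i j ω))) ∧
        (C W).PosSemidef ∧
        TendstoInDistribution
          (fun (n : ℕ) ω => WithLp.toLp 2 (Real.sqrt n •
            (Collab.aggregate e (Collab.covMat P) W
              (Collab.localEstimates e θ n (fun i j => x i j ω) (fun i j => ξ i j ω)) - θ)))
          atTop (id : EuclideanSpace ℝ (Fin d) → EuclideanSpace ℝ (Fin d)) (fun _ => μ)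
          (multivariateGaussian 0 (C W))) ∧
      (∀ i, (Collab.optWeight (e i) P θ σ).PosDef) ∧
      C (fun i => Collab.optWeight (e i) P θ σ) =
        (∑ i, (Collab.T (e i) (Collab.covMat P))ᵀ * Collab.optWeight (e i) P θ σ *
          Collab.T (e i) (Collab.covMat P))⁻¹ ∧
      ∀ W : ∀ i, Matrix (Fin (p i)) (Fin (p i)) ℝ, (∀ i, (W i).PosDef) →
        (C W - C (fun i => Collab.optWeight (e i) P θ σ)).PosSemidef := by
  have hν_var : Var[fun y => y; gaussianReal 0 (σ ^ 2)] = (σ : ℝ) ^ 2 := by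
    simp [variance_fun_id_gaussianReal]
  exact mainTheorem3_general e hcover P hP2 hmean hcov (fun _ => gaussianReal 0 (σ ^ 2))
    (fun _ => memLp_id_gaussianReal 2) (fun _ => integral_id_gaussianReal) θ (fun _ => σ)
    (fun _ => NNReal.coe_ne_zero.2 hσ.ne') (fun _ => hν_var) hP4 μ x ξ hx hξ hxξ hindep
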